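/- **Model.** Base stations (BSs) form a homogeneous Poisson point process of intensity $\lambda_{BS}>0$ in $\mathbb R^2$; the typical user is at the origin. A link of length at most $D>0$ is independently LOS ($\mathrm L$) with probability $p_{LOS}\in[0,1]$ and NLOS ($\mathrm N$) otherwise; links longer than $D$ are NLOS. A link of type $j\in\{\mathrm L,\mathrm N\}$ and length $r$ has path loss $L=10^{(\beta+10\alpha_j\log_{10}r+s)/10}$ with $\beta=20\log_{10}(4\pi/\lambda_c)$ and independent shadowing $s\sim N(0,\xi_j^2)$ ($\alpha_j,\xi_j,\lambda_c>0$), and has $\eta_j\ge1$ paths with i.i.d. complex normal gains $\gamma_i$ of mean $0$ and unit variance. The user is served by the BS $x$ of least path loss. The load $N_x$ of that BS has, with $\rho=\lambda_{UE}/\lambda_{BS}$ ($\lambda_{UE}>0$ the user density), the PMF $\kappa(0)=0$, $$\kappa(n)=\frac{3.5^{3.5}}{(n-1)!}\frac{\Gamma(n+3.5)}{\Gamma(3.5)}\rho^{n-1}(3.5+\rho)^{-n-3.5}\qquad(n\ge1),$$ and $U_x=\min(U_M,N_x)$ users are served per time slot ($U_M\ge1$). With transmit power $\mathrm P>0$,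 noise power $\sigma_n^2>0$, $N_{BS},N_{UE}\ge1$ antennas and $G=\mathrm P N_{BS}N_{UE}$, the SNR of the typical user is $$\mathrm{SNR}_{x,0}=\frac{G}{\eta_jU_x\sigma_n^2}\max_{i\le\eta_j}|\gamma_i|^2\,L^{-1}\,p_{MU},$$ where $j$, $\gamma_i$, $L$ belong to the serving link and the zero-forcing penalty $p_{MU}$ is, given $j$ and $U_x$, Bernoulli with success probability $\zeta(\eta_j,U_x)$. The locations, LOS states of links within $D$, shadowings, gains, zero-forcing penalties and the load are otherwise mutually independent. The network is noise-limited ($\mathrm{SINR}=\mathrm{SNR}$), so the rate of the user is $R_{x,0}=\omega_{MU}\,\mathrm B\,\frac{U_x}{N_x}\log_2(1+\mathrm{SNR}_{x,0})$ with bandwidth $\mathrm B>0$ and efficiency $\omega_{MU}>0$. Here, for $a\in\{BS,UE\}$, $q_{a,i}=\frac1\pi\left(\arcsin(-1+\frac{2i+1}{N_a})-\arcsin(-1+\frac{2i-1}{N_a})\right)$ for $1\le i<N_a$, $q_{a,N_a}=1-\sum_{i<N_a}q_{a,i}$, and $$\zeta(\eta,U)=\sum_{j=1}^{N_{BS}}q_{BS,j}B_j(\eta,U)\big(p_{LOS}A_j(\eta_{\mathrm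 L})+(1-p_{LOS})A_j(\eta_{\mathrm N})\big)^{U-1},$$ $C(\eta)=\sum_{i=1}^{N_{UE}}q_{UE,i}(1-q_{UE,i})^{\eta-1}$, $A_j(\eta)=C(\eta)+(1-q_{BS,j})^{\eta-1}(1-C(\eta))$, $B_j(\eta,U)=C(\eta)(1-q_{BS,j})^{U-1}+D_j(\eta,U)(1-C(\eta))$, $$D_j(\eta,U)=\sum_{i_1,\dots,i_{\eta-1}=1}^{N_{BS}-1}\Big(\prod_{n=1}^{\eta-1}l_{i_n,j}\Big)\Big(1-\sum_{v\in\{i_1,\dots,i_{\eta-1}\}}l_{v,j}\Big)^{U-1},$$ where the inner sum is over distinct values, $l_{n,j}=q_{BS,n}/(1-q_{BS,j})$ for $n<j$ and $l_{n,j}=q_{BS,n+1}/(1-q_{BS,j})$ for $n\ge j$. Let $\mathrm Q$ be the standard Gaussian complementary distribution function, $m=-0.1\beta\ln10$, $\sigma_j=0.1\xi_j\ln10$, $\Upsilon_j(t)=\frac{\ln(D^{\alpha_j}/t)-m}{\sigma_j}$, $e_j(t)=t^{2/\alpha_j}\exp\left(\frac{2\sigma_j^2}{\alpha_j^2}+\frac{2m}{\alpha_j}\right)$,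 $$M_{\mathrm L}(t)=\pi p_{LOS}\Big[D^2\mathrm Q(\Upsilon_{\mathrm L}(t))+e_{\mathrm L}(t)\,\mathrm Q\Big(\frac{2\sigma_{\mathrm L}}{\alpha_{\mathrm L}}-\Upsilon_{\mathrm L}(t)\Big)\Big],$$ $$M_{\mathrm N}(t)=-\pi p_{LOS}D^2\mathrm Q(\Upsilon_{\mathrm N}(t))+\pi e_{\mathrm N}(t)\Big[1-p_{LOS}\,\mathrm Q\Big(\frac{2\sigma_{\mathrm N}}{\alpha_{\mathrm N}}-\Upsilon_{\mathrm N}(t)\Big)\Big],$$ $\mathrm B_{\mathrm L}=1-e^{-\lambda_{BS}\pi p_{LOS}D^2}$, $\mathrm B_{\mathrm N}=1$, $f_j(t)=\lambda_{BS}e^{-\lambda_{BS}M_j(t)}M_j'(t)/\mathrm B_j$ (read as $0$ if $\mathrm B_j=0$), and, with $\bar j$ the other link type, $$\mathcal S(\tau,U)=\sum_{j\in\{\mathrm L,\mathrm N\}}\mathrm B_j\,\zeta(\eta_j,U)\sum_{n=1}^{\eta_j}(-1)^{n+1}\binom{\eta_j}{n}\int_0^\infty\exp\Big(-\frac{\eta_j\tau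 nUl\sigma_n^2}{G}-\lambda_{BS}M_{\bar j}(l)\Big)f_j(l)\,dl.$$ **Theorem.** For every $\tau_r\ge0$ the integrals in the terms below converge, the series converges, and $$\mathbb P(R_{x,0}>\tau_r)=\sum_{n\ge1}\kappa(n)\,\mathcal S\Big(2^{\frac{\tau_rn}{\omega_{MU}\mathrm B\min(n,U_M)}}-1,\ \min(n,U_M)\Big).$$ -/

import Mathlib

open MeasureTheory ProbabilityTheory Set
open scoped Nat NNReal ENNReal BigOperators

noncomputable section

namespace MmWave

/-- Line-of-sight and non-line-of-sight links. -/
inductive LinkType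
  | los
  | nlos

/-- The other link type. -/
def LinkType.other : LinkType → LinkType
  | .los => .nlos
  | .nlos => .los

/-- Deterministic parameters of the downlink network. -/
structure Params where
  /-- density of base stations (BSs) per unit area -/
  lamBS : ℝ
  /-- density of users (UEs) per unit area -/
  lamUE : ℝ
  /-- probability that a link of length at most `D` is LOS -/
  pLOS : ℝ
  /-- LOS ball radius -/
  D : ℝ
  /-- carrier wavelength, in meters -/
  wavelength : ℝ
  /-- path loss exponent -/
  α : LinkType → ℝ
  /-- standard deviation (in dB) of the shadowing -/
  ξ : LinkType → ℝ
  /-- number of paths of a link -/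
  η : LinkType → ℕ
  /-- number of antennas at a BS -/
  NBS : ℕ
  /-- number of antennas at a user -/
  NUE : ℕ
  /-- maximal number of users that a BS schedules in one time slot -/
  UM : ℕ
  /-- transmit power -/
  power : ℝ
  /-- noise power -/
  noise : ℝ
  /-- bandwidth -/
  bandwidth : ℝ
  /-- efficiency factor of multi-user MIMO -/
  eff : ℝ
  lamBS_pos : 0 < lamBS
  lamUE_pos : 0 < lamUE
  pLOS_nonneg : 0 ≤ pLOS
  pLOS_le_one : pLOS ≤ 1
  D_pos : 0 < D
  wavelength_pos : 0 < wavelength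
  α_pos : ∀ j, 0 < α j
  ξ_pos : ∀ j, 0 < ξ j
  η_pos : ∀ j, 0 < η j
  NBS_pos : 0 < NBS
  NUE_pos : 0 < NUE
  UM_pos : 0 < UM
  power_pos : 0 < power
  noise_pos : 0 < noise
  bandwidth_pos : 0 < bandwidth
  eff_pos : 0 < eff

/-! ### Zero-forcing penalty -/

/-- Probability of the `i`-th quantized virtual angle, `1 ≤ i ≤ N`, of an array of `N` antennas. -/
def angleProb (N i : ℕ) : ℝ :=
  if i < N then
    (Real.arcsin (-1 + (2 * i + 1) / N) - Real.arcsin (-1 + (2 * i - 1) / N)) / Real.pi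
  else
    1 - ∑ k ∈ Finset.Icc 1 (N - 1),
      (Real.arcsin (-1 + (2 * k + 1) / N) - Real.arcsin (-1 + (2 * k - 1) / N)) / Real.pi

namespace Params

variable (P : Params)

/-- `q_{BS,j}` -/
def qBS (j : ℕ) : ℝ := angleProb P.NBS j

/-- `q_{UE,i}` -/
def qUE (i : ℕ) : ℝ := angleProb P.NUE i

/-- `C(η)` -/
def zfC (η : ℕ) : ℝ := ∑ i ∈ Finset.Icc 1 P.NUE, P.qUE i * (1 - P.qUE i) ^ (η - 1)

/-- `A_j(η)` -/
def zfA (j η : ℕ) : ℝ :=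
  P.zfC η + (1 - P.qBS j) ^ (η - 1) - (1 - P.qBS j) ^ (η - 1) * P.zfC η

/-- `l_{n,j}` -/
def zfl (n j : ℕ) : ℝ :=
  if n < j then P.qBS n / (1 - P.qBS j) else P.qBS (n + 1) / (1 - P.qBS j)

/-- `D_j(η, U)`: the sum over all `(i_1, …, i_{η-1})` in `{1, …, NBS - 1}^{η-1}`; the inner sum is
over the distinct values among the `i_n`. -/
def zfD (j η U : ℕ) : ℝ :=
  ∑ i ∈ Fintype.piFinset (fun _ : Fin (η - 1) => Finset.Icc 1 (P.NBS - 1)),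
    (∏ n, P.zfl (i n) j) * (1 - ∑ v ∈ Finset.univ.image i, P.zfl v j) ^ (U - 1)

/-- `B_j(η, U)` -/
def zfB (j η U : ℕ) : ℝ :=
  P.zfC η * (1 - P.qBS j) ^ (U - 1) + P.zfD j η U - P.zfD j η U * P.zfC η

/-- `ζ(η, U)` -/
def zeta (η U : ℕ) : ℝ :=
  ∑ j ∈ Finset.Icc 1 P.NBS, P.qBS j * P.zfB j η U *
    (P.pLOS * P.zfA j (P.η .los) + (1 - P.pLOS) * P.zfA j (P.η .nlos)) ^ (U - 1)

/-! ### Load -/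

/-- `κ(n)`, the PMF of the number of users of the BS that serves the typical user. -/
def kappa (n : ℕ) : ℝ :=
  if n = 0 then 0
  else (3.5 : ℝ) ^ (3.5 : ℝ) / ((n - 1)! : ℕ) * (Real.Gamma (n + 3.5) / Real.Gamma 3.5) *
    (P.lamUE / P.lamBS) ^ (n - 1) * (3.5 + P.lamUE / P.lamBS) ^ (-(n : ℝ) - 3.5)

/-! ### Path loss and the SNR coverage function -/

/-- `β`, the path loss in dB at one meter. -/
def β : ℝ := 20 * Real.logb 10 (4 * Real.pi / P.wavelength)

/-- Path loss (linear scale) of a link of type `j`, length `r` and shadowing `s` (in dB). -/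
def pathLoss (j : LinkType) (r s : ℝ) : ℝ :=
  (10 : ℝ) ^ ((P.β + 10 * P.α j * Real.logb 10 r + s) / 10)

/-- `G` -/
def G : ℝ := P.power * P.NBS * P.NUE

/-- `m` -/
def m : ℝ := -(0.1 * P.β * Real.log 10)

/-- `σ_j` -/
def σ (j : LinkType) : ℝ := 0.1 * P.ξ j * Real.log 10

/-- `Υ_j(t)` -/
def Upsilon (j : LinkType) (t : ℝ) : ℝ := (Real.log (P.D ^ P.α j / t) - P.m) / P.σ j

end Params

/-- The Q-function: complementary distribution function of the standard Gaussian law. -/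
def Q (x : ℝ) : ℝ := (gaussianReal 0 1).real (Ioi x)

namespace Params

variable (P : Params)

/-- `M_L(t)` and `M_N(t)` -/
def M : LinkType → ℝ → ℝ
  | .los, t => Real.pi * P.pLOS *
      (P.D ^ 2 * Q (P.Upsilon .los t) +
        t ^ (2 / P.α .los) *
          Real.exp (2 * P.σ .los ^ 2 / P.α .los ^ 2 + 2 * P.m / P.α .los) *
          Q (2 * P.σ .los ^ 2 / (P.α .los * P.σ .los) - P.Upsilon .los t))
  | .nlos, t => -(Real.pi * P.pLOS * P.D ^ 2 * Q (P.Upsilon .nlos t)) +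
      Real.pi * t ^ (2 / P.α .nlos) *
        Real.exp (2 * P.σ .nlos ^ 2 / P.α .nlos ^ 2 + 2 * P.m / P.α .nlos) *
        (1 - P.pLOS * Q (2 * P.σ .nlos ^ 2 / (P.α .nlos * P.σ .nlos) - P.Upsilon .nlos t))

/-- `M'_L(t)` and `M'_N(t)`; the factor `pLOS` is multiplied into the brackets of `M'_N`, so that
the formula makes sense for `pLOS = 0` too. -/
def M' : LinkType → ℝ → ℝ
  | .los, t => Real.pi * P.pLOS *
      (Real.exp (2 * P.σ .los ^ 2 / P.α .los ^ 2 + 2 * P.m / P.α .los) *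
          t ^ (2 / P.α .los - 1) *
          (2 / P.α .los * Q (2 * P.σ .los ^ 2 / (P.α .los * P.σ .los) - P.Upsilon .los t) -
            1 / √(2 * Real.pi * P.σ .los ^ 2) *
              Real.exp (-(√2 * P.σ .los / P.α .los - P.Upsilon .los t / √2) ^ 2)) +
        P.D ^ 2 / (√(2 * Real.pi) * t * P.σ .los) * Real.exp (-(P.Upsilon .los t ^ 2 / 2)))
  | .nlos, t => Real.pi *
      (Real.exp (2 * P.σ .nlos ^ 2 / P.α .nlos ^ 2 + 2 * P.m / P.α .nlos) *
          t ^ (2 / P.α .nlos - 1) *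
          (2 / P.α .nlos - P.pLOS *
            (2 / P.α .nlos *
                Q (2 * P.σ .nlos ^ 2 / (P.α .nlos * P.σ .nlos) - P.Upsilon .nlos t) -
              1 / √(2 * Real.pi * P.σ .nlos ^ 2) *
                Real.exp (-(√2 * P.σ .nlos / P.α .nlos - P.Upsilon .nlos t / √2) ^ 2))) -
        P.pLOS *
          (P.D ^ 2 / (√(2 * Real.pi) * t * P.σ .nlos) * Real.exp (-(P.Upsilon .nlos t ^ 2 / 2))))

/-- `B_L` and `B_N`, the probability that there is a BS with a link of the given type. -/
def B : LinkType → ℝ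
  | .los => 1 - Real.exp (-(P.lamBS * Real.pi * P.pLOS * P.D ^ 2))
  | .nlos => 1

/-- `f_L` and `f_N`, density of the least path loss among the links of the given type. -/
def f (j : LinkType) (t : ℝ) : ℝ :=
  P.lamBS * Real.exp (-(P.lamBS * P.M j t)) * P.M' j t / P.B j

/-- The integrand in `S(τ, U)`. -/
def covIntegrand (j : LinkType) (τ : ℝ) (U n : ℕ) (l : ℝ) : ℝ :=
  Real.exp (-(P.η j * τ * n * U * l * P.noise / P.G) - P.lamBS * P.M j.other l) * P.f j l

/-- The summand of `S(τ, U)` that belongs to link type `j`. -/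
def covTerm (j : LinkType) (τ : ℝ) (U : ℕ) : ℝ :=
  P.B j * P.zeta (P.η j) U *
    ∑ n ∈ Finset.Icc 1 (P.η j), (-1 : ℝ) ^ (n + 1) * (P.η j).choose n *
      ∫ l in Ioi (0 : ℝ), P.covIntegrand j τ U n l

/-- `S(τ, U)` -/
def S (τ : ℝ) (U : ℕ) : ℝ := P.covTerm .los τ U + P.covTerm .nlos τ U

/-- The SNR threshold for rate `τ` at a user whose BS has load `n`. -/
def snrThreshold (τ : ℝ) (n : ℕ) : ℝ :=
  (2 : ℝ) ^ (τ * n / (P.eff * P.bandwidth * (min n P.UM : ℕ))) - 1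

end Params

/-! ### The random network -/

/-- The random points `X 0, X 1, …` form a Poisson point process with intensity measure `Λ`: the
numbers of points in disjoint sets of finite intensity are independent Poisson variables. -/
structure IsPoissonProcess {Ω E : Type*} [MeasurableSpace Ω] [MeasurableSpace E]
    (X : ℕ → Ω → E) (Λ : Measure E) (μ : Measure Ω) : Prop where
  measurable : ∀ i, Measurable (X i)
  count : ∀ (k : ℕ) (A : Fin k → Set E), (∀ a, MeasurableSet (A a)) →
    Pairwise (fun a b => Disjoint (A a) (A b)) → (∀ a, Λ (A a) ≠ ∞) → ∀ n : Fin k → ℕ,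
    μ.real {ω | ∀ a, {i | X i ω ∈ A a}.encard = (n a : ℕ∞)} =
      ∏ a, Real.exp (-(Λ (A a)).toReal) * (Λ (A a)).toReal ^ n a / (n a)!

/-- The circularly symmetric complex normal law with mean zero and unit variance. -/
def complexNormal : Measure ℂ :=
  ((gaussianReal 0 (1 / 2)).prod (gaussianReal 0 (1 / 2))).map (fun z => (⟨z.1, z.2⟩ : ℂ))

/-- The random network as seen from the typical user, who is at the origin. -/
structure Network (P : Params) {Ω : Type*} [MeasurableSpace Ω] (μ : Measure Ω) where
  /-- locations of the BSs -/
  loc : ℕ → Ω → EuclideanSpace ℝ (Fin 2)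
  /-- the link to BS `i` is LOS if it is unblocked and has length at most `D` -/
  unblocked : ℕ → Ω → Bool
  /-- `shadow j i` is the shadowing (in dB) on the link to BS `i` if that link has type `j` -/
  shadow : LinkType → ℕ → Ω → ℝ
  /-- `fading i k` is the small scale fading on path `k` of the link to BS `i` -/
  fading : ℕ → ℕ → Ω → ℂ
  /-- `zf j U` is the zero-forcing penalty on a serving link of type `j` when the serving BS serves
  `U` users in the time slot -/
  zf : LinkType → ℕ → Ω → ℝ
  /-- number of users of the BS that serves the typical user -/
  load : Ω → ℕ
  loc_poisson : IsPoissonProcess loc (ENNReal.ofReal P.lamBS • volume) μ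
  unblocked_measurable : ∀ i, Measurable (unblocked i)
  unblocked_law : ∀ i, μ.real {ω | unblocked i ω = true} = P.pLOS
  unblocked_indep : iIndepFun unblocked μ
  shadow_measurable : ∀ j i, Measurable (shadow j i)
  shadow_law : ∀ j i, μ.map (shadow j i) = gaussianReal 0 (Real.toNNReal (P.ξ j ^ 2))
  shadow_indep : iIndepFun (fun a : LinkType × ℕ => shadow a.1 a.2) μ
  fading_measurable : ∀ i k, Measurable (fading i k)
  fading_law : ∀ i k, μ.map (fading i k) = complexNormal
  fading_indep : iIndepFun (fun a : ℕ × ℕ => fading a.1 a.2) μ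
  zf_measurable : ∀ j U, Measurable (zf j U)
  zf_range : ∀ j U ω, zf j U ω = 0 ∨ zf j U ω = 1
  zf_law : ∀ j U, 1 ≤ U → μ.real {ω | zf j U ω = 1} = P.zeta (P.η j) U
  load_measurable : Measurable load
  load_law : ∀ n, μ.real {ω | load ω = n} = P.kappa n
  /- The next five fields together: the six sources of randomness are mutually independent. -/
  indep_loc : IndepFun (fun ω i => loc i ω) (fun ω => (fun i => unblocked i ω,
    fun j i => shadow j i ω, fun i k => fading i k ω, fun j U => zf j U ω, load ω)) μ
  indep_unblocked : IndepFun (fun ω i => unblocked i ω) (fun ω =>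
    (fun j i => shadow j i ω, fun i k => fading i k ω, fun j U => zf j U ω, load ω)) μ
  indep_shadow : IndepFun (fun ω j i => shadow j i ω) (fun ω =>
    (fun i k => fading i k ω, fun j U => zf j U ω, load ω)) μ
  indep_fading : IndepFun (fun ω i k => fading i k ω) (fun ω =>
    (fun j U => zf j U ω, load ω)) μ
  indep_zf : IndepFun (fun ω j U => zf j U ω) load μ

namespace Network

variable {P : Params} {Ω : Type*} [MeasurableSpace Ω] {μ : Measure Ω} (W : Network P μ)

/-- Type of the link from BS `i` to the typical user. -/
def linkType (i : ℕ) (ω : Ω) : LinkType :=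
  open Classical in if W.unblocked i ω = true ∧ ‖W.loc i ω‖ ≤ P.D then .los else .nlos

/-- Path loss from BS `i` to the typical user. -/
def loss (i : ℕ) (ω : Ω) : ℝ :=
  P.pathLoss (W.linkType i ω) ‖W.loc i ω‖ (W.shadow (W.linkType i ω) i ω)

/-- The tagged BS: the (first) one that offers the minimal path loss. -/
def tagged (ω : Ω) : ℕ := sInf {i | ∀ k, W.loss i ω ≤ W.loss k ω}

/-- Type of the serving link. -/
def servingType (ω : Ω) : LinkType := W.linkType (W.tagged ω) ω

/-- Number of users that the tagged BS serves in a time slot. -/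
def numServed (ω : Ω) : ℕ := min P.UM (W.load ω)

/-- The strongest fading power among the paths of the serving link. -/
def bestFading (ω : Ω) : ℝ :=
  ⨆ k : Fin (P.η (W.servingType ω)), ‖W.fading (W.tagged ω) k ω‖ ^ 2

/-- SNR of the typical user. -/
def snr (ω : Ω) : ℝ :=
  P.G / (P.η (W.servingType ω) * W.numServed ω * P.noise) * W.bestFading ω *
    (W.loss (W.tagged ω) ω)⁻¹ * W.zf (W.servingType ω) (W.numServed ω) ω

/-- Rate of the typical user in the noise-limited network (where SINR = SNR). -/
def rate (ω : Ω) : ℝ :=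
  P.eff * (P.bandwidth * W.numServed ω / W.load ω) * Real.logb 2 (1 + W.snr ω)

end Network

end MmWave

end

/-! Attach to each base station its blockage and shadowing. The stations whose link has type j and
loss at most t number on average `lamBS * meanCount j t`, and for t > 0 `meanCount j t` is the
closed form M_j(t) (`meanCount_eq_and_nonneg`): it is a Gaussian average of the areas of discs, or
of their intersections with the LOS ball.

The Poisson property makes the two types independent. Keep each station below its type's threshold
with probability ε. Given the locations, the probability that none is kept is a product over
stations, and the generating functional `iInf_lintegral_prod` evaluates its mean as exp(-ε λ (M_L(s)
+ M_N(t))). Letting ε tend to 0 shows that almost surely only finitely many losses lie below any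
level (`ae_finite_loss_le`), so least losses are attained. Taking ε = 1 gives the joint tail of the
two least losses (`measure_lt_leastLoss_and`). It factors, so they are independent, with densities λ
M_j' exp(-λ M_j) = B_j f_j.

Ties are null, so the serving type is j exactly when the least loss of type j is below that of the
other type. Hence serving type and serving loss have joint density exp(-λ M_j̄(l)) B_j f_j(l)
(`lintegral_serving`). Gains, penalties and load are independent of the configuration that selects
the serving station, so they may be integrated with the station held fixed. The squared gains are
exponential of mean one; the maximum of η of them exceeds x with probability 1 - (1 - exp(-x))^η,
whose binomial expansion is the alternating sum in S. At load n, the rate exceeds the threshold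
exactly when the penalty equals 1 and the best gain exceeds a fixed multiple of the serving loss
(`rate_gt_and_load_iff`). Countable additivity over n gives both convergence and value of the
series. -/

namespace MmWave

open Filter Topology

/-! ### Independence and integration -/

section General

variable {Ω α β γ : Type*} [MeasurableSpace Ω] [MeasurableSpace α] [MeasurableSpace β]
  [MeasurableSpace γ] {μ : Measure Ω}

/-- Tonelli for the product law of `(f, g)`. Integrating `g` over a second copy of Ω with `f` frozen
does the work of conditioning throughout. -/
lemma lintegral_indepFun [IsFiniteMeasure μ] {f : Ω → α} {g : Ω → β} (hf : Measurable f)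
    (hg : Measurable g) (h : IndepFun f g μ) {F : α → β → ℝ≥0∞}
    (hF : Measurable (Function.uncurry F)) :
    ∫⁻ ω, F (f ω) (g ω) ∂μ = ∫⁻ ω, ∫⁻ ω', F (f ω) (g ω') ∂μ ∂μ := by
  have h1 := (indepFun_iff_map_prod_eq_prod_map_map hf.aemeasurable hg.aemeasurable).1 h
  calc ∫⁻ ω, F (f ω) (g ω) ∂μ
      = ∫⁻ z, Function.uncurry F z ∂(μ.map fun ω => (f ω, g ω)) := by
        rw [lintegral_map hF (hf.prodMk hg)]; rfl
    _ = ∫⁻ x, ∫⁻ y, F x y ∂(μ.map g) ∂(μ.map f) := by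
        rw [h1, lintegral_prod _ hF.aemeasurable]; rfl
    _ = ∫⁻ ω, ∫⁻ y, F (f ω) y ∂(μ.map g) ∂μ :=
        lintegral_map hF.lintegral_prod_right hf
    _ = _ := by
        exact lintegral_congr fun ω => lintegral_map (hF.comp measurable_prodMk_left) hg

/-- Associativity of product measures. It regroups the chain of independence assumptions of a
network into independence of blocks. -/
lemma indepFun_prodMk_left [IsProbabilityMeasure μ] {f : Ω → α} {g : Ω → β} {k : Ω → γ}
    (hf : Measurable f) (hg : Measurable g) (hk : Measurable k)
    (h : IndepFun f (fun ω => (g ω, k ω)) μ) (h' : IndepFun g k μ) :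
    IndepFun (fun ω => (f ω, g ω)) k μ := by
  have h1 := (indepFun_iff_map_prod_eq_prod_map_map hf.aemeasurable
    (hg.prodMk hk).aemeasurable).1 h
  have h2 := (indepFun_iff_map_prod_eq_prod_map_map hg.aemeasurable hk.aemeasurable).1 h'
  have h3 : IndepFun f g μ := h.comp measurable_id measurable_fst
  have h4 := (indepFun_iff_map_prod_eq_prod_map_map hf.aemeasurable hg.aemeasurable).1 h3
  have : IsProbabilityMeasure (μ.map f) := Measure.isProbabilityMeasure_map hf.aemeasurable
  have : IsProbabilityMeasure (μ.map g) := Measure.isProbabilityMeasure_map hg.aemeasurable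
  have : IsProbabilityMeasure (μ.map k) := Measure.isProbabilityMeasure_map hk.aemeasurable
  refine (indepFun_iff_map_prod_eq_prod_map_map (hf.prodMk hg).aemeasurable hk.aemeasurable).2 ?_
  rw [h4]
  apply (MeasurableEquiv.prodAssoc : (α × β) × γ ≃ᵐ α × β × γ).map_measurableEquiv_injective
  rw [Measure.prodAssoc_prod, ← h2, ← h1, Measure.map_map (MeasurableEquiv.measurable _)
    ((hf.prodMk hg).prodMk hk)]
  rfl

lemma lintegral_one_sub [IsProbabilityMeasure μ] {F : Ω → ℝ≥0∞} (hF : Measurable F)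
    (h : ∀ ω, F ω ≤ 1) : ∫⁻ ω, (1 - F ω) ∂μ = 1 - ∫⁻ ω, F ω ∂μ := by
  rw [lintegral_sub hF _ (Eventually.of_forall h)]
  · simp
  · exact ((lintegral_mono h).trans_lt (by simp)).ne

lemma lintegral_le_one [IsProbabilityMeasure μ] {F : Ω → ℝ≥0∞}
    (h : ∀ ω, F ω ≤ 1) : ∫⁻ ω, F ω ∂μ ≤ 1 :=
  (lintegral_mono h).trans (by simp)

/-- Two extended nonnegative random variables whose joint tail factors are independent. -/
lemma indepFun_of_tail [IsProbabilityMeasure μ] {X Y : Ω → ℝ≥0∞} (hX : Measurable X)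
    (hY : Measurable Y) (h : ∀ s t : ℝ≥0, μ {ω | s < X ω ∧ t < Y ω} =
      μ {ω | s < X ω} * μ {ω | t < Y ω}) : IndepFun X Y μ := by
  have hpi : ∀ Z : Ω → ℝ≥0∞, IsPiSystem {s | ∃ t ∈ range (Ioi : ℝ≥0∞ → Set ℝ≥0∞), Z ⁻¹' t = s} :=
    fun Z => isPiSystem_Ioi.comap Z
  have hgen : ∀ Z : Ω → ℝ≥0∞, MeasurableSpace.comap Z inferInstance =
      MeasurableSpace.generateFrom {s | ∃ t ∈ range (Ioi : ℝ≥0∞ → Set ℝ≥0∞), Z ⁻¹' t = s} := by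
    intro Z
    rw [BorelSpace.measurable_eq (α := ℝ≥0∞), borel_eq_generateFrom_Ioi,
      MeasurableSpace.comap_generateFrom]
    rfl
  refine IndepSets.indep hX.comap_le hY.comap_le (hpi X) (hpi Y) (hgen X) (hgen Y) ?_
  rw [IndepSets_iff]
  rintro _ _ ⟨_, ⟨s, rfl⟩, rfl⟩ ⟨_, ⟨t, rfl⟩, rfl⟩
  -- The ray above ∞ is empty, so finite thresholds suffice.
  induction s with
  | top => simp
  | coe s =>
    induction t with
    | top => simp
    | coe t => exact h s t

end General

/-! ### Generating functional of a Poisson process -/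

/-- Multiplying the Poisson(r) weights by v^n gives exp(-r(1 - v)) times the Poisson(rv) weights,
which sum to one. -/
lemma lintegral_pow_poissonMeasure (r v : ℝ≥0) :
    ∫⁻ n, (v : ℝ≥0∞) ^ n ∂(poissonMeasure r) = ENNReal.ofReal (Real.exp (-(r * (1 - v)))) := by
  have h := (hasSum_one_poissonMeasure (r * v)).mul_left (Real.exp (-(r * (1 - v))))
  rw [mul_one] at h
  rw [poissonMeasure, lintegral_sum_measure, ← h.tsum_eq,
    ENNReal.ofReal_tsum_of_nonneg (fun n => by positivity) h.summable]
  refine tsum_congr fun n => ?_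
  rw [lintegral_smul_measure, lintegral_dirac, smul_eq_mul, ← ENNReal.coe_pow,
    ← ENNReal.ofReal_coe_nnreal, ← ENNReal.ofReal_mul (by positivity)]
  congr 1
  have : Real.exp (-(r * (1 - v))) * Real.exp (-((r * v : ℝ≥0) : ℝ)) = Real.exp (-r) := by
    rw [← Real.exp_add]; congr 1; push_cast; ring
  rw [← this]
  push_cast
  ring

namespace IsPoissonProcess

variable {Ω E : Type*} [MeasurableSpace Ω] [MeasurableSpace E] {X : ℕ → Ω → E} {Λ : Measure E}
  {μ : Measure Ω}

lemma measurable_encard (hX : IsPoissonProcess X Λ μ) {A : Set E} (hA : MeasurableSet A) :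
    Measurable fun ω => {i | X i ω ∈ A}.encard :=
  _root_.measurable_encard.comp (measurable_set_iff.2 fun i =>
    measurable_mem.2 (hX.measurable i hA))

variable [IsProbabilityMeasure μ]

lemma pi_singleton (hX : IsPoissonProcess X Λ μ) {k : ℕ} {A : Fin k → Set E}
    (hA : ∀ a, MeasurableSet (A a)) (hd : Pairwise (fun a b => Disjoint (A a) (A b)))
    (hf : ∀ a, Λ (A a) ≠ ∞) (n : Fin k → ℕ) :
    Measure.pi (fun a => poissonMeasure (Λ (A a)).toNNReal) {n} =
      μ {ω | ∀ a, {i | X i ω ∈ A a}.encard = (n a : ℕ∞)} := by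
  have h := hX.count k A hA hd hf n
  rw [Measure.pi_singleton, ← ofReal_measureReal (measure_ne_top _ _), h,
    ENNReal.ofReal_prod_of_nonneg (fun a _ => by positivity)]
  exact Finset.prod_congr rfl fun a _ => poissonMeasure_singleton _ _

/-- `toNat` sends infinite counts to 0, so a priori only an inequality holds on singletons. Both
sides are probability measures, which forces equality. -/
lemma map_count (hX : IsPoissonProcess X Λ μ) {k : ℕ} {A : Fin k → Set E}
    (hA : ∀ a, MeasurableSet (A a)) (hd : Pairwise (fun a b => Disjoint (A a) (A b)))
    (hf : ∀ a, Λ (A a) ≠ ∞) :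
    μ.map (fun ω a => {i | X i ω ∈ A a}.encard.toNat) =
      Measure.pi (fun a => poissonMeasure (Λ (A a)).toNNReal) := by
  have hm : Measurable (fun ω a => {i | X i ω ∈ A a}.encard.toNat) :=
    measurable_pi_lambda _ fun a => Measurable.of_discrete.comp (hX.measurable_encard (hA a))
  have := Measure.isProbabilityMeasure_map (μ := μ) hm.aemeasurable
  refine (Measure.eq_of_le_of_measure_univ_eq ?_ (by simp)).symm
  refine Measure.le_iff.2 fun s _ => ?_
  rw [← Measure.tsum_indicator_apply_singleton _ s (.of_discrete),
    ← Measure.tsum_indicator_apply_singleton _ s (.of_discrete)]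
  refine ENNReal.tsum_le_tsum fun n => indicator_le_indicator ?_
  rw [hX.pi_singleton hA hd hf, Measure.map_apply hm (.of_discrete)]
  refine measure_mono fun ω hω => ?_
  simp only [mem_preimage, mem_singleton_iff]
  funext a
  rw [hω a, ENat.toNat_natCast]

/-- The events that prescribe finite counts are disjoint, and their Poisson probabilities already
sum to one. -/
lemma ae_finite (hX : IsPoissonProcess X Λ μ) {k : ℕ} {A : Fin k → Set E}
    (hA : ∀ a, MeasurableSet (A a)) (hd : Pairwise (fun a b => Disjoint (A a) (A b)))
    (hf : ∀ a, Λ (A a) ≠ ∞) : ∀ᵐ ω ∂μ, ∀ a, {i | X i ω ∈ A a}.Finite := by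
  have hms : ∀ n : Fin k → ℕ,
      MeasurableSet {ω | ∀ a, {i | X i ω ∈ A a}.encard = (n a : ℕ∞)} := fun n => by
    simp only [ofPred_forall]
    exact MeasurableSet.iInter fun a => hX.measurable_encard (hA a) (measurableSet_singleton _)
  have h : μ (⋃ n : Fin k → ℕ, {ω | ∀ a, {i | X i ω ∈ A a}.encard = (n a : ℕ∞)}) = 1 := by
    rw [measure_iUnion _ hms]
    · simp_rw [← hX.pi_singleton hA hd hf]
      have h := Measure.tsum_indicator_apply_singleton
        (Measure.pi (fun a => poissonMeasure (Λ (A a)).toNNReal)) univ .univ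
      simpa using h
    · intro n n' hn
      rw [Function.onFun, Set.disjoint_left]
      intro ω h1 h2
      refine hn (funext fun a => ?_)
      exact_mod_cast (h1 a).symm.trans (h2 a)
  have h' := (mem_ae_iff_prob_eq_one (MeasurableSet.iUnion hms)).2 h
  filter_upwards [h'] with ω hω a
  obtain ⟨n, hn⟩ := mem_iUnion.1 hω
  exact finite_of_encard_eq_coe (hn a)

lemma lintegral_prod_pow_count (hX : IsPoissonProcess X Λ μ) {k : ℕ} {A : Fin k → Set E}
    (hA : ∀ a, MeasurableSet (A a)) (hd : Pairwise (fun a b => Disjoint (A a) (A b)))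
    (hf : ∀ a, Λ (A a) ≠ ∞) (v : Fin k → ℝ≥0) :
    ∫⁻ ω, ∏ a, (v a : ℝ≥0∞) ^ {i | X i ω ∈ A a}.encard.toNat ∂μ =
      ENNReal.ofReal (Real.exp (-∑ a, (Λ (A a)).toReal * (1 - v a))) := by
  have hm : Measurable (fun ω a => {i | X i ω ∈ A a}.encard.toNat) :=
    measurable_pi_lambda _ fun a => Measurable.of_discrete.comp (hX.measurable_encard (hA a))
  have h1 := lintegral_map (μ := μ) (f := fun n : Fin k → ℕ => ∏ a, (v a : ℝ≥0∞) ^ n a)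
    .of_discrete hm
  rw [← h1, hX.map_count hA hd hf]
  have hi : iIndepFun (fun (a : Fin k) (n : Fin k → ℕ) => (v a : ℝ≥0∞) ^ n a)
      (Measure.pi (fun a => poissonMeasure (Λ (A a)).toNNReal)) :=
    iIndepFun_pi (X := fun a n => (v a : ℝ≥0∞) ^ n) (fun a => Measurable.of_discrete.aemeasurable)
  rw [lintegral_prod_eq_prod_lintegral_of_indepFun _ _ hi (fun a => .of_discrete),
    ← Finset.sum_neg_distrib, Real.exp_sum,
    ENNReal.ofReal_prod_of_nonneg (fun a _ => by positivity)]
  refine Finset.prod_congr rfl fun a _ => ?_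
  rw [← lintegral_map (f := fun n : ℕ => (v a : ℝ≥0∞) ^ n) .of_discrete (measurable_pi_apply a)]
  rw [Measure.pi_map_eval]
  simp [lintegral_pow_poissonMeasure, ENNReal.coe_toNNReal_eq_toReal]

lemma antitone_prod_range {v : ℕ → ℝ≥0∞} (h : ∀ i, v i ≤ 1) :
    Antitone fun m => ∏ i ∈ Finset.range m, v i :=
  antitone_nat_of_succ_le fun m => by
    rw [Finset.prod_range_succ]
    exact mul_le_of_le_one_right' (h m)

/-- Probability generating functional of a Poisson process at a simple function. -/
lemma lintegral_iInf_prod_simpleFunc (hX : IsPoissonProcess X Λ μ) (g : SimpleFunc E ℝ≥0∞)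
    (hg : ∀ x, g x ≤ 1) (hfin : ∫⁻ x, g x ∂Λ ≠ ∞) :
    ∫⁻ ω, ⨅ m, ∏ i ∈ Finset.range m, (1 - g (X i ω)) ∂μ =
      ENNReal.ofReal (Real.exp (-(∫⁻ x, g x ∂Λ).toReal)) := by
  classical
  -- Zero is left out: its level set may have infinite intensity, and its points contribute only the
  -- factor 1. Every other level set has finite intensity because the integral of `g` is finite.
  set S := g.range.filter (· ≠ 0) with hS
  let e := S.equivFin.symm
  set k := S.card
  let a : Fin k → ℝ≥0∞ := fun b => (e b : ℝ≥0∞)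
  have ha0 : ∀ b, a b ≠ 0 := fun b => (Finset.mem_filter.1 (e b).2).2
  have ha1 : ∀ b, a b ≤ 1 := fun b => by
    obtain ⟨x, hx⟩ := SimpleFunc.mem_range.1 (Finset.mem_filter.1 (e b).2).1
    exact hx.symm.trans_le (hg x)
  have hat : ∀ b, a b ≠ ∞ := fun b => ((ha1 b).trans_lt ENNReal.one_lt_top).ne
  have hinj : Function.Injective a := fun b b' h => e.injective (Subtype.ext h)
  have hsurj : ∀ x, g x ≠ 0 → ∃ b, g x = a b := fun x hx =>
    ⟨e.symm ⟨g x, by simp [hS, hx]⟩, by simp [a]⟩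
  let A : Fin k → Set E := fun b => g ⁻¹' {a b}
  have hA : ∀ b, MeasurableSet (A b) := fun b => g.measurableSet_fiber _
  have hd : Pairwise (fun b b' => Disjoint (A b) (A b')) := fun b b' hb => by
    refine Set.disjoint_left.2 fun x h1 h2 => ?_
    exact hb (hinj ((mem_singleton_iff.1 h1).symm.trans (mem_singleton_iff.1 h2)))
  have hint : ∫⁻ x, g x ∂Λ = ∑ b, a b * Λ (A b) := by
    rw [SimpleFunc.lintegral_eq_lintegral, SimpleFunc.lintegral_eq_of_subset' (s := S)]
    · rw [← Finset.sum_coe_sort, ← e.sum_comp]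
    · intro x hx
      simpa [hS, and_comm] using hx
  have hf : ∀ b, Λ (A b) ≠ ∞ := fun b hb => by
    refine hfin ?_
    rw [hint, ENNReal.sum_eq_top]
    exact ⟨b, Finset.mem_univ _, by rw [hb, ENNReal.mul_top (ha0 b)]⟩
  let v : Fin k → ℝ≥0 := fun b => (1 - a b).toNNReal
  have hv : ∀ b, (v b : ℝ≥0∞) = 1 - a b := fun b =>
    ENNReal.coe_toNNReal (ENNReal.sub_ne_top ENNReal.one_ne_top)
  have hfac : ∀ x, 1 - g x = ∏ b, if x ∈ A b then (v b : ℝ≥0∞) else 1 := by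
    intro x
    by_cases hx : g x = 0
    · rw [Finset.prod_eq_one, hx, tsub_zero]
      intro b _
      rw [if_neg]
      exact fun h => ha0 b ((mem_singleton_iff.1 h).symm.trans hx)
    · obtain ⟨b, hb⟩ := hsurj x hx
      rw [Finset.prod_eq_single b, if_pos (by exact hb), hv, hb]
      · intro b' _ hb'
        rw [if_neg]
        exact fun h => hb' (hinj ((mem_singleton_iff.1 h).symm.trans hb))
      · simp
  -- Almost surely only finitely many points lie in these level sets, so the partial products are
  -- eventually constant.
  have hprod : ∀ᵐ ω ∂μ, ⨅ m, ∏ i ∈ Finset.range m, (1 - g (X i ω)) =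
      ∏ b, (v b : ℝ≥0∞) ^ {i | X i ω ∈ A b}.encard.toNat := by
    filter_upwards [hX.ae_finite hA hd hf] with ω hω
    refine tendsto_nhds_unique (tendsto_atTop_iInf (antitone_prod_range fun i => tsub_le_self)) ?_
    refine tendsto_const_nhds.congr' ?_
    obtain ⟨M, hM⟩ := (Set.finite_iUnion hω).bddAbove
    filter_upwards [eventually_gt_atTop M] with m hm
    simp_rw [hfac]
    rw [Finset.prod_comm]
    refine Finset.prod_congr rfl fun b _ => ?_
    rw [← Finset.prod_filter, Finset.prod_const]
    congr 1
    have : {i | X i ω ∈ A b} = ((Finset.range m).filter (fun i => X i ω ∈ A b) : Finset ℕ) := by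
      ext i
      simp only [mem_ofPred_eq, Finset.coe_filter, Finset.mem_range, iff_and_self]
      exact fun hi => (hM (mem_iUnion.2 ⟨b, hi⟩)).trans_lt hm
    rw [this, Set.encard_coe_eq_coe_finsetCard, ENat.toNat_natCast]
  rw [lintegral_congr_ae hprod, hX.lintegral_prod_pow_count hA hd hf, hint,
    ENNReal.toReal_sum fun b _ => ENNReal.mul_ne_top (hat b) (hf b)]
  congr 3
  refine Finset.sum_congr rfl fun b _ => ?_
  have : ((v b : ℝ≥0) : ℝ) = 1 - (a b).toReal := by
    rw [← ENNReal.coe_toReal, hv, ENNReal.toReal_sub_of_le (ha1 b) ENNReal.one_ne_top,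
      ENNReal.toReal_one]
  rw [this, ENNReal.toReal_mul]
  ring

/-- Probability generating functional of a Poisson process. -/
lemma iInf_lintegral_prod (hX : IsPoissonProcess X Λ μ) {g : E → ℝ≥0∞} (hgm : Measurable g)
    (hg : ∀ x, g x ≤ 1) (hfin : ∫⁻ x, g x ∂Λ ≠ ∞) :
    ⨅ m, ∫⁻ ω, ∏ i ∈ Finset.range m, (1 - g (X i ω)) ∂μ =
      ENNReal.ofReal (Real.exp (-(∫⁻ x, g x ∂Λ).toReal)) := by
  have hle : ∀ k x, SimpleFunc.eapprox g k x ≤ g x := fun k x => by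
    rw [← SimpleFunc.iSup_eapprox_apply hgm x]
    exact le_iSup (fun k => SimpleFunc.eapprox g k x) k
  have hmono : ∀ x, Monotone fun k => SimpleFunc.eapprox g k x := fun x k k' h =>
    SimpleFunc.monotone_eapprox g h x
  have hfin' : ∀ k, ∫⁻ x, SimpleFunc.eapprox g k x ∂Λ ≠ ∞ := fun k =>
    ((lintegral_mono (hle k)).trans_lt hfin.lt_top).ne
  have hanti : ∀ m ω, Antitone fun k =>
      ∏ i ∈ Finset.range m, (1 - SimpleFunc.eapprox g k (X i ω)) := fun m ω k k' h =>
    Finset.prod_le_prod' fun i _ => tsub_le_tsub_left (hmono _ h) _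
  have hlim : ∀ m ω, ⨅ k, ∏ i ∈ Finset.range m, (1 - SimpleFunc.eapprox g k (X i ω)) =
      ∏ i ∈ Finset.range m, (1 - g (X i ω)) := by
    intro m ω
    refine tendsto_nhds_unique (tendsto_atTop_iInf (hanti m ω)) ?_
    refine ENNReal.tendsto_finsetProd_of_ne_top _ (fun i _ => ?_) fun i _ =>
      ENNReal.sub_ne_top ENNReal.one_ne_top
    refine ENNReal.Tendsto.sub tendsto_const_nhds ?_ (Or.inl ENNReal.one_ne_top)
    rw [← SimpleFunc.iSup_eapprox_apply hgm]
    exact tendsto_atTop_iSup (hmono _)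
  have hmeas : ∀ k m, Measurable fun ω =>
      ∏ i ∈ Finset.range m, (1 - SimpleFunc.eapprox g k (X i ω)) := fun k m =>
    Finset.measurable_fun_prod _ fun i _ =>
      measurable_const.sub ((SimpleFunc.measurable _).comp (hX.measurable i))
  have hone : ∀ k m, ∫⁻ ω, ∏ i ∈ Finset.range m, (1 - SimpleFunc.eapprox g k (X i ω)) ∂μ ≠ ∞ :=
    fun k m => ((lintegral_le_one fun ω => Finset.prod_le_one' fun i _ =>
      tsub_le_self).trans_lt ENNReal.one_lt_top).ne
  simp_rw [← hlim]
  have h1 : ∀ m, ∫⁻ ω, ⨅ k, ∏ i ∈ Finset.range m, (1 - SimpleFunc.eapprox g k (X i ω)) ∂μ =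
      ⨅ k, ∫⁻ ω, ∏ i ∈ Finset.range m, (1 - SimpleFunc.eapprox g k (X i ω)) ∂μ := fun m =>
    lintegral_iInf (fun k => hmeas k m) (fun k k' h ω => hanti m ω h) (hone 0 m)
  simp_rw [h1]
  -- Products decrease both in the number of factors and in the approximation of `g`, so the limits
  -- are infima and commute; the inner one is then the case of a simple function.
  rw [iInf_comm]
  have h2 : ∀ k, ⨅ m, ∫⁻ ω, ∏ i ∈ Finset.range m, (1 - SimpleFunc.eapprox g k (X i ω)) ∂μ =
      ENNReal.ofReal (Real.exp (-(∫⁻ x, SimpleFunc.eapprox g k x ∂Λ).toReal)) := fun k => by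
    rw [← lintegral_iInf (hmeas k)
      (fun m m' h ω => antitone_prod_range (fun i => tsub_le_self) h) (hone k 0)]
    exact hX.lintegral_iInf_prod_simpleFunc _ (fun x => (hle k x).trans (hg x)) (hfin' k)
  simp_rw [h2]
  refine tendsto_nhds_unique (tendsto_atTop_iInf ?_) ?_
  · intro k k' h
    refine ENNReal.ofReal_le_ofReal (Real.exp_le_exp.2 (neg_le_neg ?_))
    exact ENNReal.toReal_mono (hfin' k') (lintegral_mono fun x => hmono x h)
  · refine ENNReal.tendsto_ofReal ((Real.continuous_exp.tendsto _).comp (Tendsto.neg ?_))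
    refine (ENNReal.tendsto_toReal hfin).comp ?_
    have : ∫⁻ x, g x ∂Λ = ⨆ k, ∫⁻ x, SimpleFunc.eapprox g k x ∂Λ := by
      rw [← lintegral_iSup (fun k => SimpleFunc.measurable _)
        (fun k k' h x => hmono x h)]
      simp_rw [SimpleFunc.iSup_eapprox_apply hgm]
    rw [this]
    exact tendsto_atTop_iSup fun k k' h => lintegral_mono fun x => hmono x h

end IsPoissonProcess

/-! ### Gaussian integrals and the Q-function -/

lemma gaussian_Iic_eq_Q (y : ℝ) : gaussianReal 0 1 (Iic y) = ENNReal.ofReal (Q (-y)) := by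
  have h : (gaussianReal 0 1).map (fun x => -x) = gaussianReal 0 1 := by
    rw [gaussianReal_map_neg, neg_zero]
  have := nullSingletonClass_gaussianReal (μ := 0) (v := 1) one_ne_zero
  rw [Q, ofReal_measureReal (measure_ne_top _ _), ← Iio_ae_eq_Iic.measure_eq]
  conv_lhs => rw [← h, Measure.map_apply measurable_neg measurableSet_Iio]
  congr 1
  ext x
  simp

lemma Q_nonneg (x : ℝ) : 0 ≤ Q x := measureReal_nonneg

lemma Q_le_one (x : ℝ) : Q x ≤ 1 := measureReal_le_one

lemma gaussian_Ioi_eq_Q (y : ℝ) : gaussianReal 0 1 (Ioi y) = ENNReal.ofReal (Q y) :=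
  (ofReal_measureReal (measure_ne_top _ _)).symm

/-- Completing the square: the weight exp(aw) shifts the mean of the standard Gaussian to a, at the
cost of the factor exp(a²/2). -/
lemma setLIntegral_exp_gaussian (a : ℝ) {s : Set ℝ} (hs : MeasurableSet s) :
    ∫⁻ w in s, ENNReal.ofReal (Real.exp (a * w)) ∂(gaussianReal 0 1) =
      ENNReal.ofReal (Real.exp (a ^ 2 / 2)) * gaussianReal a 1 s := by
  rw [gaussianReal_apply a one_ne_zero, gaussianReal_of_var_ne_zero 0 one_ne_zero,
    setLIntegral_withDensity_eq_setLIntegral_mul _ (measurable_gaussianPDF _ _) (by fun_prop) hs,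
    ← lintegral_const_mul _ (measurable_gaussianPDF _ _)]
  refine lintegral_congr fun w => ?_
  simp only [Pi.mul_apply, gaussianPDF_def]
  rw [← ENNReal.ofReal_mul (gaussianPDFReal_nonneg _ _ _), ← ENNReal.ofReal_mul (by positivity)]
  congr 1
  simp only [gaussianPDFReal]
  rw [mul_assoc, ← Real.exp_add, mul_left_comm, ← Real.exp_add]
  congr 2
  push_cast
  ring

lemma lintegral_exp_gaussian (a : ℝ) :
    ∫⁻ w, ENNReal.ofReal (Real.exp (a * w)) ∂(gaussianReal 0 1) =
      ENNReal.ofReal (Real.exp (a ^ 2 / 2)) := by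
  rw [← setLIntegral_univ, setLIntegral_exp_gaussian a .univ, measure_univ, mul_one]

lemma setLIntegral_Iic_exp_gaussian (a u : ℝ) :
    ∫⁻ w in Iic u, ENNReal.ofReal (Real.exp (a * w)) ∂(gaussianReal 0 1) =
      ENNReal.ofReal (Real.exp (a ^ 2 / 2) * Q (a - u)) := by
  rw [setLIntegral_exp_gaussian a measurableSet_Iic, ENNReal.ofReal_mul (by positivity),
    ← neg_sub u a, ← gaussian_Iic_eq_Q]
  congr 1
  have h : (gaussianReal 0 1).map (· + a) = gaussianReal a 1 := by
    rw [gaussianReal_map_add_const, zero_add]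
  rw [← h, Measure.map_apply (measurable_add_const a) measurableSet_Iic]
  congr 1
  ext x
  simp [le_sub_iff_add_le]

lemma hasDerivAt_Q (x : ℝ) :
    HasDerivAt Q (-((√(2 * Real.pi))⁻¹ * Real.exp (-(x ^ 2 / 2)))) x := by
  have hpdf : ∀ y, gaussianPDFReal 0 1 y = (√(2 * Real.pi))⁻¹ * Real.exp (-(y ^ 2 / 2)) := by
    intro y; simp [gaussianPDFReal, neg_div]
  have hint := integrable_gaussianPDFReal 0 1
  have hc : Continuous (gaussianPDFReal 0 1) := by
    rw [funext hpdf]; fun_prop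
  have hQ : ∀ y, Q y = Q 0 - ∫ z in (0 : ℝ)..y, gaussianPDFReal 0 1 z := by
    intro y
    have hI : ∀ y, Q y = 1 - ∫ z in Iic y, gaussianPDFReal 0 1 z := by
      intro y
      rw [Q, ← compl_Iic, probReal_compl_eq_one_sub measurableSet_Iic, measureReal_def,
        gaussianReal_apply_eq_integral 0 one_ne_zero,
        ENNReal.toReal_ofReal (integral_nonneg fun _ => gaussianPDFReal_nonneg _ _ _)]
    rw [hI y, hI 0, ← intervalIntegral.integral_Iic_sub_Iic hint.integrableOn hint.integrableOn]
    ring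
  rw [funext hQ, ← hpdf]
  exact (intervalIntegral.integral_hasDerivAt_right hint.intervalIntegrable
    (hc.stronglyMeasurableAtFilter _ _) hc.continuousAt).const_sub _

lemma tendsto_Q_atTop : Tendsto Q atTop (𝓝 0) := by
  have h := tendsto_measure_iInter_atTop (μ := gaussianReal 0 1) (s := fun x : ℝ => Ioi x)
    (fun x => measurableSet_Ioi.nullMeasurableSet) (fun a b h => Ioi_subset_Ioi h)
    ⟨0, measure_ne_top _ _⟩
  have h0 : ⋂ x : ℝ, Ioi x = ∅ := by
    ext y; simp only [mem_iInter, mem_Ioi, mem_empty_iff_false, iff_false, not_forall]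
    exact ⟨y, lt_irrefl y⟩
  rw [h0, measure_empty] at h
  exact (ENNReal.tendsto_toReal ENNReal.zero_ne_top).comp h

/-- The plane. -/
abbrev Plane := EuclideanSpace ℝ (Fin 2)

/-! ### Mean number of links below a path loss level -/

namespace Params

variable (P : Params)

/-- Law of the shadowing (in dB) on links of type `j`. -/
noncomputable def shadowLaw (j : LinkType) : Measure ℝ := gaussianReal 0 (Real.toNNReal (P.ξ j ^ 2))

instance (j : LinkType) : IsProbabilityMeasure (P.shadowLaw j) := by
  unfold shadowLaw; infer_instance

lemma σ_pos (j : LinkType) : 0 < P.σ j := by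
  have := P.ξ_pos j
  have : 0 < Real.log 10 := Real.log_pos (by norm_num)
  unfold σ
  positivity

lemma pathLoss_pos (j : LinkType) (r s : ℝ) : 0 < P.pathLoss j r s :=
  Real.rpow_pos_of_pos (by norm_num) _

lemma measurable_pathLoss (j : LinkType) : Measurable fun z : ℝ × ℝ => P.pathLoss j z.1 z.2 := by
  unfold pathLoss Real.logb
  fun_prop

/-- The probability that a link of type `j` and length `r` has path loss at most `t`. -/
noncomputable def lossCdf (j : LinkType) (t r : ℝ) : ℝ≥0∞ := P.shadowLaw j {s | P.pathLoss j r s ≤ t}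

lemma measurableSet_pathLoss_le (j : LinkType) (t : ℝ) :
    MeasurableSet {z : Plane × ℝ | P.pathLoss j ‖z.1‖ z.2 ≤ t} := by
  have h : Measurable fun z : Plane × ℝ => P.pathLoss j ‖z.1‖ z.2 :=
    (P.measurable_pathLoss j).comp (g := fun z : ℝ × ℝ => P.pathLoss j z.1 z.2)
      (f := fun z : Plane × ℝ => (‖z.1‖, z.2)) (by fun_prop)
  exact measurableSet_le h measurable_const

lemma measurable_lossCdf (j : LinkType) (t : ℝ) :
    Measurable fun x : Plane => P.lossCdf j t ‖x‖ :=
  measurable_measure_prodMk_left (P.measurableSet_pathLoss_le j t)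

/-- Path loss is at most `t` exactly within this distance, for shadowing `-σ w`. -/
noncomputable def reach (j : LinkType) (t w : ℝ) : ℝ := Real.exp ((Real.log t + P.m + P.σ j * w) / P.α j)

/-- After taking logarithms both inequalities are affine in log r and w. The sign of the shadowing,
harmless by Gaussian symmetry (`map_shadow`), makes `reach` increasing in w. The length 0 is
excluded because `Real.log 0` is a default value. -/
lemma pathLoss_le_iff {j : LinkType} {t r w : ℝ} (ht : 0 < t) (hr : 0 < r) :
    P.pathLoss j r (-(P.ξ j * w)) ≤ t ↔ r ≤ P.reach j t w := by
  have hα := P.α_pos j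
  have hl : 0 < Real.log 10 := Real.log_pos (by norm_num)
  rw [← Real.log_le_log_iff (P.pathLoss_pos _ _ _) ht, reach,
    ← Real.log_le_iff_le_exp hr, le_div_iff₀ hα, pathLoss, Real.log_rpow (by norm_num), m, σ,
    Real.logb]
  rw [← sub_nonneg, ← sub_nonneg (b := Real.log r * P.α j)]
  have : Real.log t - (P.β + 10 * P.α j * (Real.log r / Real.log 10) + -(P.ξ j * w)) / 10 *
      Real.log 10 = Real.log t + -(0.1 * P.β * Real.log 10) + 0.1 * P.ξ j * Real.log 10 * w -
      Real.log r * P.α j := by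
    field_simp
    ring
  rw [this]

lemma reach_sq {j : LinkType} {t w : ℝ} (ht : 0 < t) :
    P.reach j t w ^ 2 = t ^ (2 / P.α j) * Real.exp (2 * P.m / P.α j) *
      Real.exp (2 * P.σ j / P.α j * w) := by
  rw [reach, Real.rpow_def_of_pos ht, ← Real.exp_add, ← Real.exp_add, ← Real.exp_nat_mul]
  congr 1
  push_cast
  ring

lemma reach_le_D_iff {j : LinkType} {t w : ℝ} (ht : 0 < t) :
    P.reach j t w ≤ P.D ↔ w ≤ P.Upsilon j t := by
  have hα := P.α_pos j
  have hD := P.D_pos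
  rw [reach, ← Real.le_log_iff_exp_le hD, div_le_iff₀ hα, Upsilon, le_div_iff₀ (P.σ_pos j),
    Real.log_div (by positivity) ht.ne', Real.log_rpow hD]
  constructor <;> intro h <;> linarith

lemma volume_pathLoss_le {j : LinkType} {t : ℝ} (ht : 0 < t) (w : ℝ) :
    volume {x : Plane | P.pathLoss j ‖x‖ (-(P.ξ j * w)) ≤ t} =
      ENNReal.ofReal (Real.pi * P.reach j t w ^ 2) := by
  have h : {x : Plane | P.pathLoss j ‖x‖ (-(P.ξ j * w)) ≤ t} =ᵐ[volume]
      Metric.closedBall (0 : Plane) (P.reach j t w) := by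
    -- Only the origin can violate the equivalence, and it is a null set.
    filter_upwards [Measure.ae_ne volume (0 : Plane)] with x hx
    exact propext ((P.pathLoss_le_iff ht (norm_pos_iff.2 hx)).trans mem_closedBall_zero_iff.symm)
  rw [measure_congr h, EuclideanSpace.volume_closedBall_fin_two, mul_comm Real.pi,
    ENNReal.ofReal_mul (by positivity), ENNReal.ofReal_pow (show 0 ≤ P.reach j t w from (Real.exp_pos _).le)]

lemma volume_pathLoss_le_inter {j : LinkType} {t : ℝ} (ht : 0 < t) (w : ℝ) :
    volume ({x : Plane | P.pathLoss j ‖x‖ (-(P.ξ j * w)) ≤ t} ∩ Metric.closedBall 0 P.D) =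
      ENNReal.ofReal (Real.pi * min (P.reach j t w) P.D ^ 2) := by
  have h : ({x : Plane | P.pathLoss j ‖x‖ (-(P.ξ j * w)) ≤ t} ∩ Metric.closedBall 0 P.D :
      Set Plane) =ᵐ[volume] Metric.closedBall (0 : Plane) (min (P.reach j t w) P.D) := by
    filter_upwards [Measure.ae_ne volume (0 : Plane)] with x hx
    refine propext (Iff.trans ?_ mem_closedBall_zero_iff.symm)
    rw [le_min_iff]
    exact and_congr (P.pathLoss_le_iff ht (norm_pos_iff.2 hx)) mem_closedBall_zero_iff
  have : 0 ≤ min (P.reach j t w) P.D := le_min (Real.exp_pos _).le P.D_pos.le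
  rw [measure_congr h, EuclideanSpace.volume_closedBall_fin_two, mul_comm Real.pi,
    ENNReal.ofReal_mul (by positivity), ENNReal.ofReal_pow this]

lemma map_shadow (j : LinkType) : (gaussianReal 0 1).map (fun w => -(P.ξ j * w)) = P.shadowLaw j := by
  have h : (fun w => -(P.ξ j * w)) = fun w => (-P.ξ j) * w := by funext w; ring
  rw [h, gaussianReal_map_const_mul, shadowLaw, mul_zero, mul_one]
  congr 1
  ext
  simp [Real.coe_toNNReal _ (sq_nonneg _)]

/-- Tonelli: with the shadowing held fixed, the spatial integral becomes an area. -/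
lemma setLIntegral_lossCdf (j : LinkType) (t : ℝ) {A : Set Plane} (hA : MeasurableSet A) :
    ∫⁻ x in A, P.lossCdf j t ‖x‖ =
      ∫⁻ w, volume ({x : Plane | P.pathLoss j ‖x‖ (-(P.ξ j * w)) ≤ t} ∩ A) ∂(gaussianReal 0 1) := by
  have hm := P.measurableSet_pathLoss_le j t
  have h1 := Measure.prod_apply (μ := volume.restrict A) (ν := P.shadowLaw j) hm
  have h2 := Measure.prod_apply_symm (μ := volume.restrict A) (ν := P.shadowLaw j) hm
  refine (h1.symm.trans h2).trans ?_
  rw [← P.map_shadow j, lintegral_map (measurable_measure_prodMk_right hm) (by fun_prop)]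
  refine lintegral_congr fun w => ?_
  exact Measure.restrict_apply' hA

lemma lintegral_lossCdf (j : LinkType) {t : ℝ} (ht : 0 < t) :
    ∫⁻ x : Plane, P.lossCdf j t ‖x‖ = ENNReal.ofReal (Real.pi * t ^ (2 / P.α j) *
      Real.exp (2 * P.σ j ^ 2 / P.α j ^ 2 + 2 * P.m / P.α j)) := by
  rw [← setLIntegral_univ, P.setLIntegral_lossCdf j t .univ]
  simp_rw [inter_univ, P.volume_pathLoss_le ht, P.reach_sq ht, ← mul_assoc]
  have h : ∀ w, ENNReal.ofReal (Real.pi * t ^ (2 / P.α j) * Real.exp (2 * P.m / P.α j) *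
      Real.exp (2 * P.σ j / P.α j * w)) = ENNReal.ofReal (Real.pi * t ^ (2 / P.α j) *
      Real.exp (2 * P.m / P.α j)) * ENNReal.ofReal (Real.exp (2 * P.σ j / P.α j * w)) := fun w =>
    ENNReal.ofReal_mul (by positivity)
  simp_rw [h]
  rw [lintegral_const_mul _ (by fun_prop), lintegral_exp_gaussian, ← ENNReal.ofReal_mul
    (by positivity), mul_assoc _ (Real.exp _) (Real.exp _), ← Real.exp_add]
  congr 3
  ring

/-- Υ is the value of w at which the disc of radius `reach` fills the LOS ball. Below it the disc
has an area proportional to exp(2σw/α), hence a tilted Gaussian integral; above it the area is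
constantly πD². -/
lemma setLIntegral_closedBall_lossCdf (j : LinkType) {t : ℝ} (ht : 0 < t) :
    ∫⁻ x in Metric.closedBall (0 : Plane) P.D, P.lossCdf j t ‖x‖ =
      ENNReal.ofReal (Real.pi * (P.D ^ 2 * Q (P.Upsilon j t) + t ^ (2 / P.α j) *
        Real.exp (2 * P.σ j ^ 2 / P.α j ^ 2 + 2 * P.m / P.α j) *
        Q (2 * P.σ j ^ 2 / (P.α j * P.σ j) - P.Upsilon j t))) := by
  have hσ := P.σ_pos j
  have hα := P.α_pos j
  rw [P.setLIntegral_lossCdf j t Metric.isClosed_closedBall.measurableSet]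
  simp_rw [P.volume_pathLoss_le_inter ht]
  rw [← lintegral_add_compl _ (measurableSet_Iic (a := P.Upsilon j t)), compl_Iic]
  have h1 : ∫⁻ w in Iic (P.Upsilon j t), ENNReal.ofReal (Real.pi * min (P.reach j t w) P.D ^ 2)
      ∂(gaussianReal 0 1) = ∫⁻ w in Iic (P.Upsilon j t), ENNReal.ofReal (Real.pi *
        (t ^ (2 / P.α j) * Real.exp (2 * P.m / P.α j))) *
        ENNReal.ofReal (Real.exp (2 * P.σ j / P.α j * w)) ∂(gaussianReal 0 1) := by
    refine setLIntegral_congr_fun measurableSet_Iic fun w hw => ?_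
    rw [min_eq_left ((P.reach_le_D_iff ht).2 hw), P.reach_sq ht,
      ← ENNReal.ofReal_mul (by positivity), ← mul_assoc Real.pi]
  have h2 : ∫⁻ w in Ioi (P.Upsilon j t), ENNReal.ofReal (Real.pi * min (P.reach j t w) P.D ^ 2)
      ∂(gaussianReal 0 1) = ∫⁻ w in Ioi (P.Upsilon j t), ENNReal.ofReal (Real.pi * P.D ^ 2)
        ∂(gaussianReal 0 1) := by
    refine setLIntegral_congr_fun measurableSet_Ioi fun w hw => ?_
    rw [min_eq_right]
    exact (lt_of_not_ge fun h => (not_le.2 hw) ((P.reach_le_D_iff ht).1 h)).le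
  have hQ1 := Q_nonneg (P.Upsilon j t)
  have hQ2 := Q_nonneg (2 * P.σ j / P.α j - P.Upsilon j t)
  have h3 : 2 * P.σ j ^ 2 / (P.α j * P.σ j) = 2 * P.σ j / P.α j := by field_simp
  rw [h1, h2, setLIntegral_const, lintegral_const_mul _ (by fun_prop),
    setLIntegral_Iic_exp_gaussian, gaussian_Ioi_eq_Q, ← ENNReal.ofReal_mul (by positivity),
    ← ENNReal.ofReal_mul (by positivity), ← ENNReal.ofReal_add (by positivity) (by positivity), h3]
  congr 1
  have h4 : Real.exp (2 * P.σ j ^ 2 / P.α j ^ 2 + 2 * P.m / P.α j) =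
      Real.exp (2 * P.m / P.α j) * Real.exp ((2 * P.σ j / P.α j) ^ 2 / 2) := by
    rw [← Real.exp_add]; congr 1; ring
  rw [h4]
  ring

/-- The probability that a link of length `r` has type `j`. -/
noncomputable def typeProb : LinkType → ℝ → ℝ≥0∞
  | .los, r => (Iic P.D).indicator (fun _ => ENNReal.ofReal P.pLOS) r
  | .nlos, r => 1 - (Iic P.D).indicator (fun _ => ENNReal.ofReal P.pLOS) r

/-- The mean number of base stations with a link of type `j` and path loss at most `t`, for base
stations of unit density. -/
noncomputable def meanCount (j : LinkType) (t : ℝ) : ℝ≥0∞ :=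
  ∫⁻ x : Plane, P.typeProb j ‖x‖ * P.lossCdf j t ‖x‖

lemma measurable_typeProb (j : LinkType) : Measurable (P.typeProb j) := by
  cases j
  · exact measurable_const.indicator measurableSet_Iic
  · exact measurable_const.sub (measurable_const.indicator measurableSet_Iic)

lemma meanCount_los (t : ℝ) : P.meanCount .los t = ENNReal.ofReal P.pLOS *
    ∫⁻ x in Metric.closedBall (0 : Plane) P.D, P.lossCdf .los t ‖x‖ := by
  rw [meanCount, ← lintegral_const_mul _ (P.measurable_lossCdf _ _),
    ← lintegral_indicator Metric.isClosed_closedBall.measurableSet]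
  refine lintegral_congr fun x => ?_
  by_cases hx : ‖x‖ ≤ P.D <;> simp [typeProb, indicator, hx]

/-- The NLOS links are all links minus the unblocked ones in the ball. The additive form avoids
truncated subtraction. -/
lemma meanCount_nlos_add (t : ℝ) : P.meanCount .nlos t + ENNReal.ofReal P.pLOS *
    ∫⁻ x in Metric.closedBall (0 : Plane) P.D, P.lossCdf .nlos t ‖x‖ =
    ∫⁻ x : Plane, P.lossCdf .nlos t ‖x‖ := by
  rw [meanCount, ← lintegral_const_mul _ (P.measurable_lossCdf _ _),
    ← lintegral_indicator Metric.isClosed_closedBall.measurableSet,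
    ← lintegral_add_right _ (((P.measurable_lossCdf _ _).const_mul _).indicator
      Metric.isClosed_closedBall.measurableSet)]
  refine lintegral_congr fun x => ?_
  by_cases hx : ‖x‖ ≤ P.D
  · simp only [typeProb, indicator, hx, mem_Iic, mem_closedBall_zero_iff, if_true]
    rw [← add_mul, tsub_add_cancel_of_le, one_mul]
    simpa using P.pLOS_le_one
  · simp [typeProb, indicator, hx]

/-- M_N is a difference, so its sign is not evident from the formula. It is nonnegative because the
LOS share of the ball cannot exceed the integral over the plane; without this, `ENNReal.ofReal`
would lose information. -/
lemma meanCount_eq_and_nonneg (j : LinkType) {t : ℝ} (ht : 0 < t) :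
    P.meanCount j t = ENNReal.ofReal (P.M j t) ∧ 0 ≤ P.M j t := by
  have hp := P.pLOS_nonneg
  cases j
  · have hQ1 := Q_nonneg (P.Upsilon .los t)
    have hQ2 := Q_nonneg (2 * P.σ .los ^ 2 / (P.α .los * P.σ .los) - P.Upsilon .los t)
    refine ⟨?_, by unfold M; positivity⟩
    rw [P.meanCount_los, P.setLIntegral_closedBall_lossCdf _ ht, ← ENNReal.ofReal_mul hp]
    congr 1
    simp only [M]
    ring
  · have hQ1 := Q_nonneg (P.Upsilon .nlos t)
    have hQ2 := Q_nonneg (2 * P.σ .nlos ^ 2 / (P.α .nlos * P.σ .nlos) - P.Upsilon .nlos t)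
    have h := P.meanCount_nlos_add t
    rw [P.setLIntegral_closedBall_lossCdf _ ht, P.lintegral_lossCdf _ ht,
      ← ENNReal.ofReal_mul hp] at h
    have h1 := ENNReal.eq_sub_of_add_eq ENNReal.ofReal_ne_top h
    have h2 : ENNReal.ofReal (P.pLOS * (Real.pi * (P.D ^ 2 * Q (P.Upsilon .nlos t) +
        t ^ (2 / P.α .nlos) *
        Real.exp (2 * P.σ .nlos ^ 2 / P.α .nlos ^ 2 + 2 * P.m / P.α .nlos) *
        Q (2 * P.σ .nlos ^ 2 / (P.α .nlos * P.σ .nlos) - P.Upsilon .nlos t)))) ≤ _ :=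
      h ▸ le_add_self
    rw [ENNReal.ofReal_le_ofReal_iff (by positivity)] at h2
    rw [← ENNReal.ofReal_sub _ (by positivity)] at h1
    rw [h1]
    refine ⟨?_, ?_⟩
    · congr 1
      simp only [M]
      ring
    · simp only [M]
      linarith

lemma meanCount_of_nonpos (j : LinkType) {t : ℝ} (ht : t ≤ 0) : P.meanCount j t = 0 := by
  have : ∀ r, P.lossCdf j t r = 0 := fun r => by
    have h : {s | P.pathLoss j r s ≤ t} = ∅ := by
      ext s
      simpa using ht.trans_lt (P.pathLoss_pos j r s)
    rw [lossCdf, h, measure_empty]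
  simp [meanCount, this]

lemma meanCount_ne_top (j : LinkType) (t : ℝ) : P.meanCount j t ≠ ∞ := by
  rcases le_or_gt t 0 with ht | ht
  · simp [P.meanCount_of_nonpos j ht]
  · simp [(P.meanCount_eq_and_nonneg j ht).1]

lemma monotone_meanCount (j : LinkType) : Monotone fun t => (P.meanCount j t).toReal := fun _ t h =>
  ENNReal.toReal_mono (P.meanCount_ne_top j t) (lintegral_mono fun _ =>
    mul_le_mul_right (measure_mono fun _ hs => le_trans hs h) _)

lemma toReal_meanCount (j : LinkType) {t : ℝ} (ht : 0 < t) : (P.meanCount j t).toReal = P.M j t := by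
  rw [(P.meanCount_eq_and_nonneg j ht).1, ENNReal.toReal_ofReal (P.meanCount_eq_and_nonneg j ht).2]

end Params

/-! ### Derivative of M and density of the least path loss -/

namespace Params

variable (P : Params)

lemma hasDerivAt_Upsilon (j : LinkType) {t : ℝ} (ht : 0 < t) :
    HasDerivAt (P.Upsilon j) (-(1 / (t * P.σ j))) t := by
  have hD := P.D_pos
  have hσ := P.σ_pos j
  have h : HasDerivAt (fun t => (Real.log (P.D ^ P.α j) - Real.log t - P.m) / P.σ j)
      ((-t⁻¹) / P.σ j) t :=
    (((Real.hasDerivAt_log ht.ne').const_sub _).sub_const _).div_const _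
  have h' : P.Upsilon j =ᶠ[𝓝 t] fun t => (Real.log (P.D ^ P.α j) - Real.log t - P.m) / P.σ j := by
    filter_upwards [lt_mem_nhds ht] with u hu
    rw [Upsilon, Real.log_div (by positivity) hu.ne']
  refine (h.congr_of_eventuallyEq h').congr_deriv ?_
  field_simp

lemma tendsto_Upsilon (j : LinkType) : Tendsto (P.Upsilon j) (𝓝[>] 0) atTop := by
  have hD := P.D_pos
  have hσ := P.σ_pos j
  have h' : (fun t => (Real.log (P.D ^ P.α j) - Real.log t - P.m) / P.σ j) =ᶠ[𝓝[>] 0]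
      P.Upsilon j := by
    filter_upwards [self_mem_nhdsWithin] with u hu
    rw [Upsilon, Real.log_div (by positivity) (ne_of_gt hu)]
  refine Tendsto.congr' h' (Tendsto.atTop_div_const hσ ?_)
  have h1 : Tendsto (fun t => -Real.log t) (𝓝[>] 0) atTop :=
    tendsto_neg_atBot_atTop.comp Real.tendsto_log_nhdsGT_zero
  have h2 := tendsto_atTop_add_const_left _ (Real.log (P.D ^ P.α j) - P.m) h1
  refine h2.congr fun t => ?_
  ring

lemma hasDerivAt_M (j : LinkType) {t : ℝ} (ht : 0 < t) : HasDerivAt (P.M j) (P.M' j t) t := by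
  have hσ := P.σ_pos j
  have hα := P.α_pos j
  have hU := P.hasDerivAt_Upsilon j ht
  have h1 : HasDerivAt (fun t => Q (P.Upsilon j t)) _ t := (hasDerivAt_Q _).comp t hU
  have h2 : HasDerivAt (fun t => Q (2 * P.σ j ^ 2 / (P.α j * P.σ j) - P.Upsilon j t)) _ t :=
    (hasDerivAt_Q _).comp t (hU.const_sub _)
  have h3 : HasDerivAt (fun t : ℝ => t ^ (2 / P.α j)) (2 / P.α j * t ^ (2 / P.α j - 1)) t :=
    Real.hasDerivAt_rpow_const (Or.inl ht.ne')
  have h4 : √(2 * Real.pi * P.σ j ^ 2) = √(2 * Real.pi) * P.σ j := by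
    rw [Real.sqrt_mul (by positivity), Real.sqrt_sq hσ.le]
  -- The exponent in `M'` is half the square of the argument of the second Q, written with √2
  -- distributed.
  have h5 : -(√2 * P.σ j / P.α j - P.Upsilon j t / √2) ^ 2 =
      -((2 * P.σ j ^ 2 / (P.α j * P.σ j) - P.Upsilon j t) ^ 2 / 2) := by
    have h2 : √2 ^ 2 = (2 : ℝ) := Real.sq_sqrt (by norm_num)
    have h6 : √2 * P.σ j / P.α j - P.Upsilon j t / √2 =
        (2 * P.σ j ^ 2 / (P.α j * P.σ j) - P.Upsilon j t) / √2 := by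
      field_simp
      rw [h2]
      ring
    rw [h6, div_pow, h2]
  have h6 : t ^ (2 / P.α j) = t ^ (2 / P.α j - 1) * t := by
    rw [Real.rpow_sub_one ht.ne']
    field_simp
  have h7 : 0 < √(2 * Real.pi) := by positivity
  cases j
  · refine (((h1.const_mul (P.D ^ 2)).add ((h3.mul_const (Real.exp (2 * P.σ .los ^ 2 /
      P.α .los ^ 2 + 2 * P.m / P.α .los))).mul h2)).const_mul (Real.pi * P.pLOS)).congr_deriv ?_
    simp only [M', h4, h5]
    rw [h6]
    generalize Q _ = q
    generalize Real.exp (2 * P.σ .los ^ 2 / P.α .los ^ 2 + 2 * P.m / P.α .los) = e1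
    generalize Real.exp _ = e2
    generalize Real.exp _ = e3
    generalize t ^ (2 / P.α .los - 1) = u
    field_simp
    ring
  · refine (((h1.const_mul (Real.pi * P.pLOS * P.D ^ 2)).neg).add (((h3.const_mul
      Real.pi).mul_const (Real.exp (2 * P.σ .nlos ^ 2 /
      P.α .nlos ^ 2 + 2 * P.m / P.α .nlos))).mul
      ((h2.const_mul P.pLOS).const_sub 1))).congr_deriv ?_
    simp only [M', h4, h5]
    rw [h6]
    generalize Q _ = q
    generalize Real.exp (2 * P.σ .nlos ^ 2 / P.α .nlos ^ 2 + 2 * P.m / P.α .nlos) = e1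
    generalize Real.exp _ = e2
    generalize Real.exp _ = e3
    generalize t ^ (2 / P.α .nlos - 1) = u
    field_simp
    ring

/-- Υ tends to infinity at 0+, which kills the first Q; the second is bounded and multiplied by a
vanishing power of t. Thus the least loss has no mass at 0. -/
lemma tendsto_M_zero (j : LinkType) : Tendsto (P.M j) (𝓝[>] 0) (𝓝 0) := by
  have hα := P.α_pos j
  have h1 : Tendsto (fun t => Q (P.Upsilon j t)) (𝓝[>] 0) (𝓝 0) :=
    tendsto_Q_atTop.comp (P.tendsto_Upsilon j)
  have h2 : Tendsto (fun t : ℝ => t ^ (2 / P.α j)) (𝓝[>] 0) (𝓝 0) := by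
    have : ContinuousAt (fun t : ℝ => t ^ (2 / P.α j)) 0 :=
      Real.continuousAt_rpow_const _ _ (Or.inr (by positivity))
    have h := this.tendsto
    rw [Real.zero_rpow (by positivity)] at h
    exact h.mono_left nhdsWithin_le_nhds
  have h3 : Tendsto (fun t => t ^ (2 / P.α j) * Q (2 * P.σ j ^ 2 / (P.α j * P.σ j) -
      P.Upsilon j t)) (𝓝[>] 0) (𝓝 0) := by
    refine h2.zero_mul_isBoundedUnder_le ⟨1, ?_⟩
    rw [eventually_map]
    refine Eventually.of_forall fun t => ?_
    simpa [abs_of_nonneg (Q_nonneg _)] using Q_le_one _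
  cases j
  · have h := ((h1.const_mul (P.D ^ 2)).add (h3.const_mul (Real.exp (2 * P.σ .los ^ 2 /
      P.α .los ^ 2 + 2 * P.m / P.α .los)))).const_mul (Real.pi * P.pLOS)
    simp only [mul_zero, add_zero] at h
    refine h.congr fun t => ?_
    simp only [M]
    ring
  · have h := ((h1.const_mul (-(Real.pi * P.pLOS * P.D ^ 2))).add
      ((h2.sub (h3.const_mul P.pLOS)).const_mul (Real.pi * Real.exp (2 * P.σ .nlos ^ 2 /
      P.α .nlos ^ 2 + 2 * P.m / P.α .nlos))))
    simp only [mul_zero, add_zero, sub_zero] at h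
    refine h.congr fun t => ?_
    simp only [M]
    ring

lemma hasDerivAt_meanCount (j : LinkType) {t : ℝ} (ht : 0 < t) :
    HasDerivAt (fun t => (P.meanCount j t).toReal) (P.M' j t) t := by
  refine (P.hasDerivAt_M j ht).congr_of_eventuallyEq ?_
  filter_upwards [lt_mem_nhds ht] with u hu using P.toReal_meanCount j hu

/-- The closed form mixes signs, but it is the derivative of a mean count, which is monotone by its
meaning. -/
lemma M'_nonneg (j : LinkType) {t : ℝ} (ht : 0 < t) : 0 ≤ P.M' j t := by
  rw [← (P.hasDerivAt_meanCount j ht).deriv]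
  exact (P.monotone_meanCount j).deriv_nonneg

/-- Density of the least path loss among the links of type `j`; its mass is the probability that
there is such a link. -/
noncomputable def lossDensity (j : LinkType) (t : ℝ) : ℝ :=
  P.lamBS * P.M' j t * Real.exp (-(P.lamBS * (P.meanCount j t).toReal))

lemma lossDensity_nonneg (j : LinkType) {t : ℝ} (ht : 0 < t) : 0 ≤ P.lossDensity j t :=
  mul_nonneg (mul_nonneg P.lamBS_pos.le (P.M'_nonneg j ht)) (Real.exp_pos _).le

/-- Probability that no link of type `j` has path loss at most `t`. -/
noncomputable def lossTail (j : LinkType) (t : ℝ) : ℝ := Real.exp (-(P.lamBS * (P.meanCount j t).toReal))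

lemma lossTail_pos (j : LinkType) (t : ℝ) : 0 < P.lossTail j t := Real.exp_pos _

lemma antitone_lossTail (j : LinkType) : Antitone (P.lossTail j) := fun _ _ h =>
  Real.exp_le_exp.2 (neg_le_neg (mul_le_mul_of_nonneg_left (P.monotone_meanCount j h)
    P.lamBS_pos.le))

lemma lossTail_of_nonpos (j : LinkType) {t : ℝ} (ht : t ≤ 0) : P.lossTail j t = 1 := by
  simp [lossTail, P.meanCount_of_nonpos j ht]

lemma lossTail_le_one (j : LinkType) (t : ℝ) : P.lossTail j t ≤ 1 := by
  have := P.lamBS_pos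
  rw [lossTail, Real.exp_le_one_iff, neg_nonpos]
  positivity

lemma hasDerivAt_neg_lossTail (j : LinkType) {t : ℝ} (ht : 0 < t) :
    HasDerivAt (fun t => -P.lossTail j t) (P.lossDensity j t) t := by
  refine (((P.hasDerivAt_meanCount j ht).const_mul P.lamBS).neg.exp.neg).congr_deriv ?_
  simp only [lossDensity, Pi.neg_apply]
  ring

lemma continuousWithinAt_lossTail_zero (j : LinkType) :
    ContinuousWithinAt (P.lossTail j) (Ici 0) 0 := by
  rw [← continuousWithinAt_Ioi_iff_Ici, ContinuousWithinAt, P.lossTail_of_nonpos j le_rfl]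
  have h := (((P.tendsto_M_zero j).const_mul P.lamBS).neg).rexp
  rw [mul_zero, neg_zero, Real.exp_zero] at h
  refine h.congr' ?_
  filter_upwards [self_mem_nhdsWithin] with u hu
  rw [lossTail, P.toReal_meanCount j hu]

/-- The antiderivative `-lossTail` is monotone and bounded above, so it has a limit at infinity; its
value is not needed. -/
lemma integrableOn_lossDensity (j : LinkType) : IntegrableOn (P.lossDensity j) (Ioi 0) := by
  refine integrableOn_Ioi_deriv_of_nonneg (P.continuousWithinAt_lossTail_zero j).neg
    (fun t ht => P.hasDerivAt_neg_lossTail j ht) (fun t ht => P.lossDensity_nonneg j ht)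
    (tendsto_atTop_ciSup (P.antitone_lossTail j).neg ⟨0, ?_⟩)
  rintro _ ⟨t, rfl⟩
  exact neg_nonpos.2 (P.lossTail_pos j t).le

lemma setIntegral_lossDensity (j : LinkType) {t : ℝ} (ht : 0 ≤ t) :
    ∫ u in Ioc 0 t, P.lossDensity j u = 1 - P.lossTail j t := by
  have hc : ContinuousOn (fun t => -P.lossTail j t) (Icc 0 t) := by
    intro u hu
    rcases eq_or_lt_of_le hu.1 with rfl | h
    · exact (P.continuousWithinAt_lossTail_zero j).neg.mono Icc_subset_Ici_self
    · exact (P.hasDerivAt_neg_lossTail j h).continuousAt.continuousWithinAt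
  rw [← intervalIntegral.integral_of_le ht,
    intervalIntegral.integral_eq_sub_of_hasDerivAt_of_le ht hc
      (fun u hu => P.hasDerivAt_neg_lossTail j hu.1)
      ((intervalIntegrable_iff_integrableOn_Ioc_of_le ht).2
        ((P.integrableOn_lossDensity j).mono_set Ioc_subset_Ioi_self)),
    P.lossTail_of_nonpos j le_rfl]
  ring

lemma setLIntegral_lossDensity (j : LinkType) {t : ℝ} (ht : 0 ≤ t) :
    ∫⁻ u in Ioc 0 t, ENNReal.ofReal (P.lossDensity j u) = 1 - ENNReal.ofReal (P.lossTail j t) := by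
  rw [← ofReal_integral_eq_lintegral_ofReal
    ((P.integrableOn_lossDensity j).mono_set Ioc_subset_Ioi_self)
    ((ae_restrict_iff' measurableSet_Ioc).2 (Eventually.of_forall fun u hu =>
      P.lossDensity_nonneg j hu.1)), P.setIntegral_lossDensity j ht,
    ENNReal.ofReal_sub _ (P.lossTail_pos j t).le, ENNReal.ofReal_one]

/-- The only degenerate case is B_L = 0. It forces pLOS = 0, so M_L' vanishes and both sides are 0,
in agreement with division by zero. -/
lemma B_mul_f (j : LinkType) {t : ℝ} (ht : 0 < t) : P.B j * P.f j t = P.lossDensity j t := by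
  rw [lossDensity, P.toReal_meanCount j ht, f]
  by_cases hB : P.B j = 0
  · cases j
    · have hp : P.pLOS = 0 := by
        have h1 : P.lamBS * Real.pi * P.pLOS * P.D ^ 2 = 0 := by
          simpa [B, sub_eq_zero, eq_comm (a := (1 : ℝ))] using hB
        have := P.lamBS_pos
        have := P.D_pos
        have := Real.pi_pos
        simp_all [ne_of_gt]
      simp [M', hp]
    · simp [B] at hB
  · field_simp

lemma f_eq (j : LinkType) {t : ℝ} (ht : 0 < t) : P.f j t = (P.B j)⁻¹ * P.lossDensity j t := by
  rw [lossDensity, P.toReal_meanCount j ht, f]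
  ring

/-- Integrand for serving links of type `j`. -/
lemma B_mul_covIntegrand (j : LinkType) (τ : ℝ) (U n : ℕ) {l : ℝ} (hl : 0 < l) :
    P.B j * P.covIntegrand j τ U n l =
      Real.exp (-(n * (P.η j * τ * U * P.noise / P.G * l))) *
        (P.lossTail j.other l * P.lossDensity j l) := by
  rw [covIntegrand, ← P.B_mul_f j hl, lossTail, P.toReal_meanCount _ hl, sub_eq_add_neg,
    Real.exp_add]
  have : P.η j * τ * n * U * l * P.noise / P.G = n * (P.η j * τ * U * P.noise / P.G * l) := by ring
  rw [this]
  ring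

lemma G_pos : 0 < P.G := by
  have := P.power_pos
  have := P.NBS_pos
  have := P.NUE_pos
  unfold G
  positivity

lemma aestronglyMeasurable_lossTail (j : LinkType) (μ : Measure ℝ) :
    AEStronglyMeasurable (P.lossTail j) μ :=
  (P.antitone_lossTail j).measurable.aestronglyMeasurable

lemma integrableOn_exp_mul_lossDensity (j : LinkType) {c : ℝ} (hc : 0 ≤ c) :
    IntegrableOn (fun l => Real.exp (-(c * l)) * (P.lossTail j.other l * P.lossDensity j l))
      (Ioi 0) := by
  have h : (fun l => Real.exp (-(c * l)) * (P.lossTail j.other l * P.lossDensity j l)) =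
      fun l => (Real.exp (-(c * l)) * P.lossTail j.other l) * P.lossDensity j l := by
    funext l; ring
  rw [h]
  refine Integrable.bdd_mul (c := 1) (P.integrableOn_lossDensity j) ?_ ?_
  · exact (Continuous.aestronglyMeasurable (by fun_prop)).mul (P.aestronglyMeasurable_lossTail _ _)
  · refine (ae_restrict_iff' measurableSet_Ioi).2 (Eventually.of_forall fun l hl => ?_)
    rw [Real.norm_of_nonneg (mul_nonneg (Real.exp_pos _).le (P.lossTail_pos _ _).le)]
    refine mul_le_one₀ ?_ (P.lossTail_pos _ _).le (P.lossTail_le_one _ _)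
    rw [Real.exp_le_one_iff, neg_nonpos]
    exact mul_nonneg hc (le_of_lt hl)

lemma snrThreshold_nonneg {τ : ℝ} (hτ : 0 ≤ τ) (n : ℕ) : 0 ≤ P.snrThreshold τ n := by
  have := P.eff_pos
  have := P.bandwidth_pos
  rw [snrThreshold, sub_nonneg]
  exact Real.one_le_rpow (by norm_num) (by positivity)

lemma integrableOn_covIntegrand (j : LinkType) {τ : ℝ} (hτ : 0 ≤ τ) (U n : ℕ) :
    IntegrableOn (P.covIntegrand j τ U n) (Ioi 0) := by
  have := P.G_pos
  have := P.noise_pos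
  have h := (P.integrableOn_exp_mul_lossDensity j
    (c := n * (P.η j * τ * U * P.noise / P.G)) (by positivity)).const_mul (P.B j)⁻¹
  refine IntegrableOn.congr_fun h (fun l hl => ?_) measurableSet_Ioi
  rw [covIntegrand, P.f_eq j hl, lossTail, P.toReal_meanCount _ hl, sub_eq_add_neg,
    Real.exp_add]
  have : P.η j * τ * n * U * l * P.noise / P.G = n * (P.η j * τ * U * P.noise / P.G) * l := by ring
  rw [this]
  ring

end Params

/-! ### Rayleigh fading and the coverage integrals -/

lemma lintegral_Ioi_two_mul_exp_neg_sq {a : ℝ} (ha : 0 ≤ a) :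
    ∫⁻ r in Ioi a, ENNReal.ofReal (2 * r * Real.exp (-r ^ 2)) =
      ENNReal.ofReal (Real.exp (-a ^ 2)) := by
  have hd : ∀ r ∈ Ici a, HasDerivAt (fun r => -Real.exp (-r ^ 2)) (2 * r * Real.exp (-r ^ 2)) r := by
    intro r _
    refine ((hasDerivAt_pow 2 r).neg.exp.neg).congr_deriv ?_
    simp only [Pi.neg_apply]
    push_cast
    ring
  have hp : ∀ r ∈ Ioi a, 0 ≤ 2 * r * Real.exp (-r ^ 2) := fun r hr => by
    have : 0 < r := ha.trans_lt hr
    positivity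
  have hl : Tendsto (fun r : ℝ => -Real.exp (-r ^ 2)) atTop (𝓝 0) := by
    rw [← neg_zero]
    exact (Real.tendsto_exp_atBot.comp
      (tendsto_neg_atTop_atBot.comp (tendsto_pow_atTop two_ne_zero))).neg
  rw [← ofReal_integral_eq_lintegral_ofReal (integrableOn_Ioi_deriv_of_nonneg' hd hp hl)
    ((ae_restrict_iff' measurableSet_Ioi).2 (Eventually.of_forall hp)),
    integral_Ioi_of_hasDerivAt_of_nonneg' hd hp hl]
  simp

/-- The density is exp(-r²)/π in polar coordinates; integrating the angle leaves 2r exp(-r²), so the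
squared modulus is exponential of mean one. -/
lemma complexNormal_lt_norm_sq {x : ℝ} (hx : 0 ≤ x) :
    complexNormal {z | x < ‖z‖ ^ 2} = ENNReal.ofReal (Real.exp (-x)) := by
  have hm : MeasurableSet {p : ℝ × ℝ | x < p.1 ^ 2 + p.2 ^ 2} :=
    measurableSet_lt measurable_const (by fun_prop)
  have hmap : Measurable fun z : ℝ × ℝ => (⟨z.1, z.2⟩ : ℂ) :=
    Complex.measurableEquivRealProd.symm.measurable
  have hpre : (fun z : ℝ × ℝ => (⟨z.1, z.2⟩ : ℂ)) ⁻¹' {z | x < ‖z‖ ^ 2} =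
      {p : ℝ × ℝ | x < p.1 ^ 2 + p.2 ^ 2} := by
    ext p
    simp only [mem_preimage, mem_ofPred_eq, Complex.sq_norm, Complex.normSq_mk]
    simp only [sq]
  rw [complexNormal, Measure.map_apply hmap (measurableSet_lt measurable_const (by fun_prop)), hpre,
    gaussianReal_of_var_ne_zero 0 (by norm_num : (1 / 2 : ℝ≥0) ≠ 0),
    prod_withDensity (measurable_gaussianPDF _ _) (measurable_gaussianPDF _ _),
    withDensity_apply _ hm, ← lintegral_indicator hm, ← Measure.volume_eq_prod,
    ← lintegral_comp_polarCoord_symm]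
  have hpdf : ∀ a b : ℝ, gaussianPDF 0 (1 / 2) a * gaussianPDF 0 (1 / 2) b =
      ENNReal.ofReal (Real.pi⁻¹ * Real.exp (-(a ^ 2 + b ^ 2))) := by
    intro a b
    rw [gaussianPDF_def, ← ENNReal.ofReal_mul (gaussianPDFReal_nonneg _ _ _)]
    congr 1
    have h1 : ∀ a : ℝ, gaussianPDFReal 0 (1 / 2) a = (√Real.pi)⁻¹ * Real.exp (-a ^ 2) := by
      intro a
      have h : (√2 : ℝ) ≠ 0 := by positivity
      simp [gaussianPDFReal]
      field_simp
    have h2 : (√Real.pi)⁻¹ * (√Real.pi)⁻¹ = Real.pi⁻¹ := by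
      rw [← mul_inv, Real.mul_self_sqrt Real.pi_pos.le]
    rw [h1, h1, mul_mul_mul_comm, ← Real.exp_add, h2]
    congr 2
    ring
  have hF : ∀ p ∈ polarCoord.target, ENNReal.ofReal p.1 •
      ({p : ℝ × ℝ | x < p.1 ^ 2 + p.2 ^ 2}.indicator (fun z => gaussianPDF 0 (1 / 2) z.1 *
        gaussianPDF 0 (1 / 2) z.2) (polarCoord.symm p)) =
      (Ioi (√x)).indicator (fun r => ENNReal.ofReal (Real.pi⁻¹ * r * Real.exp (-r ^ 2))) p.1 := by
    rintro ⟨r, θ⟩ hp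
    have hr : 0 < r := hp.1
    have hsq : (r * Real.cos θ) ^ 2 + (r * Real.sin θ) ^ 2 = r ^ 2 := by
      rw [mul_pow, mul_pow, ← mul_add, Real.cos_sq_add_sin_sq, mul_one]
    have hiff : x < r ^ 2 ↔ √x < r := (Real.sqrt_lt' hr).symm
    by_cases h : √x < r
    · rw [indicator_of_mem (by simpa [polarCoord, hsq, hiff] using h),
        indicator_of_mem (by exact h), hpdf, smul_eq_mul, ← ENNReal.ofReal_mul hr.le]
      congr 1
      simp only [polarCoord_symm_apply, hsq]
      ring
    · rw [indicator_of_notMem (by simpa [polarCoord, hsq, hiff] using h),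
        indicator_of_notMem (by exact h), smul_zero]
  rw [setLIntegral_congr_fun polarCoord.open_target.measurableSet hF]
  have ht : (volume : Measure (ℝ × ℝ)).restrict polarCoord.target =
      (volume.restrict (Ioi 0)).prod (volume.restrict (Ioo (-Real.pi) Real.pi)) := by
    rw [polarCoord_target, Measure.volume_eq_prod, Measure.prod_restrict]
  have hmi : Measurable ((Ioi (√x)).indicator
      (fun r => ENNReal.ofReal (Real.pi⁻¹ * r * Real.exp (-r ^ 2)))) :=
    Measurable.indicator (by fun_prop) measurableSet_Ioi
  rw [ht, lintegral_prod (fun p : ℝ × ℝ => (Ioi (√x)).indicator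
    (fun r => ENNReal.ofReal (Real.pi⁻¹ * r * Real.exp (-r ^ 2))) p.1)
    (hmi.comp measurable_fst).aemeasurable]
  simp only [lintegral_const, Measure.restrict_apply .univ, univ_inter, Real.volume_Ioo]
  rw [lintegral_mul_const _ hmi, setLIntegral_indicator measurableSet_Ioi,
    inter_eq_left.2 (Ioi_subset_Ioi (Real.sqrt_nonneg x)),
    ← lintegral_mul_const _ (by fun_prop)]
  rw [← Real.sq_sqrt hx, ← lintegral_Ioi_two_mul_exp_neg_sq (Real.sqrt_nonneg x),
    Real.sqrt_sq (Real.sqrt_nonneg x)]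
  refine setLIntegral_congr_fun measurableSet_Ioi fun r hr => ?_
  have hr : 0 < r := (Real.sqrt_nonneg x).trans_lt hr
  have := Real.pi_pos
  rw [← ENNReal.ofReal_mul (by positivity)]
  congr 1
  field_simp
  ring

lemma one_sub_one_sub_pow (y : ℝ) (N : ℕ) :
    1 - (1 - y) ^ N = ∑ n ∈ Finset.Icc 1 N, (-1 : ℝ) ^ (n + 1) * N.choose n * y ^ n := by
  have h : (1 - y) ^ N = ∑ n ∈ Finset.range (N + 1), (-y) ^ n * N.choose n := by
    rw [sub_eq_neg_add, add_pow]
    simp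
  have h' : Finset.range (N + 1) = insert 0 (Finset.Icc 1 N) := by
    ext n
    simp only [Finset.mem_range, Finset.mem_insert, Finset.mem_Icc]
    omega
  rw [h, h', Finset.sum_insert (by simp), pow_zero, Nat.choose_zero_right, Nat.cast_one, mul_one,
    sub_add_cancel_left, ← Finset.sum_neg_distrib]
  refine Finset.sum_congr rfl fun n _ => ?_
  rw [neg_pow y, pow_succ]
  ring

namespace Params

variable (P : Params)

/-- Probability that the strongest of `N` Rayleigh paths has power more than `x`. -/
noncomputable def fadingTail (N : ℕ) (x : ℝ) : ℝ := 1 - (1 - Real.exp (-x)) ^ N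

lemma fadingTail_nonneg {N : ℕ} {x : ℝ} (hx : 0 ≤ x) : 0 ≤ fadingTail N x := by
  rw [fadingTail, sub_nonneg]
  refine pow_le_one₀ ?_ ?_
  · rw [sub_nonneg, Real.exp_le_one_iff, neg_nonpos]; exact hx
  · have := Real.exp_pos (-x); linarith

lemma measurable_fadingTail (N : ℕ) : Measurable (fadingTail N) := by
  unfold fadingTail
  fun_prop

/-- The SNR coverage terms as a probability integral over the least path loss. -/
lemma lintegral_fadingTail_mul (j : LinkType) {τ : ℝ} (hτ : 0 ≤ τ) (U : ℕ) :
    ∫⁻ l in Ioi 0, ENNReal.ofReal (fadingTail (P.η j) (P.η j * τ * U * P.noise / P.G * l)) *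
        ENNReal.ofReal (P.lossTail j.other l * P.lossDensity j l) =
      ENNReal.ofReal (P.B j * ∑ n ∈ Finset.Icc 1 (P.η j), (-1 : ℝ) ^ (n + 1) * (P.η j).choose n *
        ∫ l in Ioi (0 : ℝ), P.covIntegrand j τ U n l) ∧
    0 ≤ P.B j * ∑ n ∈ Finset.Icc 1 (P.η j), (-1 : ℝ) ^ (n + 1) * (P.η j).choose n *
        ∫ l in Ioi (0 : ℝ), P.covIntegrand j τ U n l := by
  have hG := P.G_pos
  have hn := P.noise_pos
  set c := P.η j * τ * U * P.noise / P.G with hc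
  have hc0 : 0 ≤ c := by positivity
  have hpos : ∀ l ∈ Ioi (0 : ℝ), 0 ≤ fadingTail (P.η j) (c * l) *
      (P.lossTail j.other l * P.lossDensity j l) := fun l hl =>
    mul_nonneg (fadingTail_nonneg (mul_nonneg hc0 (le_of_lt hl)))
      (mul_nonneg (P.lossTail_pos _ _).le (P.lossDensity_nonneg j hl))
  have hexp : ∀ l, fadingTail (P.η j) (c * l) * (P.lossTail j.other l * P.lossDensity j l) =
      ∑ n ∈ Finset.Icc 1 (P.η j), (-1 : ℝ) ^ (n + 1) * (P.η j).choose n *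
        (Real.exp (-(n * c * l)) * (P.lossTail j.other l * P.lossDensity j l)) := by
    intro l
    rw [fadingTail, one_sub_one_sub_pow, Finset.sum_mul]
    refine Finset.sum_congr rfl fun n _ => ?_
    rw [← Real.exp_nat_mul, mul_neg, ← mul_assoc (n : ℝ), mul_assoc _ (Real.exp _)]
  have hint : ∀ n ∈ Finset.Icc 1 (P.η j), IntegrableOn (fun l => (-1 : ℝ) ^ (n + 1) *
      (P.η j).choose n * (Real.exp (-(n * c * l)) * (P.lossTail j.other l * P.lossDensity j l)))
      (Ioi 0) := fun n _ =>
    (P.integrableOn_exp_mul_lossDensity j (by positivity)).const_mul _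
  have hI : ∫ l in Ioi 0, fadingTail (P.η j) (c * l) *
      (P.lossTail j.other l * P.lossDensity j l) =
      P.B j * ∑ n ∈ Finset.Icc 1 (P.η j), (-1 : ℝ) ^ (n + 1) * (P.η j).choose n *
        ∫ l in Ioi (0 : ℝ), P.covIntegrand j τ U n l := by
    simp_rw [hexp]
    rw [integral_finsetSum _ hint, Finset.mul_sum]
    refine Finset.sum_congr rfl fun n _ => ?_
    rw [integral_const_mul, mul_left_comm]
    congr 1
    rw [← integral_const_mul]
    refine setIntegral_congr_fun measurableSet_Ioi fun l hl => ?_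
    rw [P.B_mul_covIntegrand j τ U n hl, ← hc, mul_assoc]
  -- The alternating sum has no evident sign; as the integral of a tail probability against a
  -- density it is nonnegative.
  rw [← hI]
  refine ⟨?_, setIntegral_nonneg measurableSet_Ioi hpos⟩
  rw [ofReal_integral_eq_lintegral_ofReal]
  · refine setLIntegral_congr_fun measurableSet_Ioi fun l hl => ?_
    exact (ENNReal.ofReal_mul (fadingTail_nonneg (mul_nonneg hc0 (le_of_lt hl)))).symm
  · simp_rw [hexp]
    exact integrable_finsetSum _ hint
  · exact (ae_restrict_iff' measurableSet_Ioi).2 (Eventually.of_forall hpos)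

end Params

/-! ### Configurations and measurability -/

namespace Params

variable (P : Params)

open Classical in
/-- Type of a link to a base station at `x` whose blockage variable is `u`. -/
noncomputable def typeOf (x : Plane) (u : Bool) : LinkType :=
  if u = true ∧ ‖x‖ ≤ P.D then .los else .nlos

/-- `LinkType` carries no σ-algebra here, so measurability is asserted for quantities selected by
the type: these are two-case choices along a measurable set. -/
lemma measurable_typeOf_comp {β γ : Type*} [MeasurableSpace β] [MeasurableSpace γ]
    {q : LinkType → β → γ} (hq : ∀ j, Measurable (q j)) {x : β → Plane} {u : β → Bool}
    (hx : Measurable x) (hu : Measurable u) : Measurable fun z => q (P.typeOf (x z) (u z)) z := by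
  classical
  have h : (fun z => q (P.typeOf (x z) (u z)) z) =
      fun z => if u z = true ∧ ‖x z‖ ≤ P.D then q .los z else q .nlos z := by
    funext z
    by_cases hz : u z = true ∧ ‖x z‖ ≤ P.D <;> simp [typeOf, hz]
  rw [h]
  exact Measurable.ite ((hu (measurableSet_singleton true)).inter
    (measurableSet_le hx.norm measurable_const)) (hq _) (hq _)

/-- Locations, blockages and shadowings, which determine all path losses. -/
abbrev Config := (ℕ → Plane) × (ℕ → Bool) × (LinkType → ℕ → ℝ)

/-- Link types in a configuration. -/
noncomputable def configType (i : ℕ) (c : Config) : LinkType := P.typeOf (c.1 i) (c.2.1 i)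

/-- Path losses in a configuration. -/
noncomputable def configLoss (i : ℕ) (c : Config) : ℝ :=
  P.pathLoss (P.configType i c) ‖c.1 i‖ (c.2.2 (P.configType i c) i)

lemma measurable_configType_comp {γ : Type*} [MeasurableSpace γ] {q : LinkType → Config → γ}
    (hq : ∀ j, Measurable (q j)) (i : ℕ) : Measurable fun c => q (P.configType i c) c :=
  P.measurable_typeOf_comp (x := fun c : Config => c.1 i) (u := fun c : Config => c.2.1 i) hq
    (by fun_prop) (by fun_prop)

lemma measurable_pathLoss_config (j : LinkType) (i : ℕ) :
    Measurable fun c : Config => P.pathLoss j ‖c.1 i‖ (c.2.2 j i) :=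
  (P.measurable_pathLoss j).comp (g := fun z : ℝ × ℝ => P.pathLoss j z.1 z.2)
    (f := fun c : Config => (‖c.1 i‖, c.2.2 j i)) (by fun_prop)

lemma measurable_configLoss (i : ℕ) : Measurable (P.configLoss i) :=
  P.measurable_configType_comp (q := fun j c => P.pathLoss j ‖c.1 i‖ (c.2.2 j i))
    (fun j => P.measurable_pathLoss_config j i) i

lemma measurableSet_configType (i : ℕ) (j : LinkType) :
    MeasurableSet {c | P.configType i c = j} :=
  measurableSet_setOfPred.2 (P.measurable_configType_comp (q := fun j' _ => j' = j)
    (fun _ => measurable_const) i)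

end Params

/-! ### Thinned void probabilities of the network -/

namespace Network

variable {P : Params} {Ω : Type*} [MeasurableSpace Ω] {μ : Measure Ω} (W : Network P μ)

/-- The configuration of the network. -/
def config (ω : Ω) : Params.Config :=
  (fun i => W.loc i ω, fun i => W.unblocked i ω, fun j i => W.shadow j i ω)

lemma measurable_locs : Measurable fun ω i => W.loc i ω :=
  measurable_pi_lambda _ W.loc_poisson.measurable

lemma measurable_unblockeds : Measurable fun ω i => W.unblocked i ω :=
  measurable_pi_lambda _ W.unblocked_measurable

lemma measurable_shadows : Measurable fun ω j i => W.shadow j i ω :=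
  measurable_pi_lambda _ fun j => measurable_pi_lambda _ (W.shadow_measurable j)

lemma measurable_config : Measurable W.config :=
  W.measurable_locs.prodMk (W.measurable_unblockeds.prodMk W.measurable_shadows)

lemma linkType_eq (i : ℕ) (ω : Ω) : W.linkType i ω = P.configType i (W.config ω) := rfl

lemma loss_eq (i : ℕ) (ω : Ω) : W.loss i ω = P.configLoss i (W.config ω) := by
  rw [loss, Params.configLoss, linkType_eq]
  simp only [config]

lemma measurable_loss (i : ℕ) : Measurable (W.loss i) := by
  rw [funext (W.loss_eq i)]
  exact (P.measurable_configLoss i).comp W.measurable_config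

lemma loss_pos (i : ℕ) (ω : Ω) : 0 < W.loss i ω := P.pathLoss_pos _ _ _

lemma measurable_linkType_comp {γ : Type*} [MeasurableSpace γ] {q : LinkType → Ω → γ}
    (hq : ∀ j, Measurable (q j)) (i : ℕ) : Measurable fun ω => q (W.linkType i ω) ω :=
  P.measurable_typeOf_comp hq (W.loc_poisson.measurable i) (W.unblocked_measurable i)

variable [IsProbabilityMeasure μ]

lemma lintegral_typeOf (i : ℕ) (x : Plane) (q : LinkType → ℝ≥0∞) :
    ∫⁻ ω, q (P.typeOf x (W.unblocked i ω)) ∂μ =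
      P.typeProb .los ‖x‖ * q .los + P.typeProb .nlos ‖x‖ * q .nlos := by
  classical
  by_cases hx : ‖x‖ ≤ P.D
  · have hm : MeasurableSet {ω | W.unblocked i ω = true} :=
      W.unblocked_measurable i (measurableSet_singleton true)
    have h1 : μ {ω | W.unblocked i ω = true} = ENNReal.ofReal P.pLOS := by
      rw [← W.unblocked_law i, ofReal_measureReal]
    rw [← lintegral_add_compl _ hm,
      setLIntegral_congr_fun hm (g := fun _ => q .los)
        (fun ω (hω : W.unblocked i ω = true) => by simp [Params.typeOf, hω, hx]),
      setLIntegral_congr_fun hm.compl (g := fun _ => q .nlos)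
        (fun ω (hω : ¬ W.unblocked i ω = true) => by simp [Params.typeOf, hω]),
      setLIntegral_const, setLIntegral_const, prob_compl_eq_one_sub hm, h1]
    simp [Params.typeProb, indicator, hx, mul_comm]
  · simp [Params.typeOf, Params.typeProb, indicator, hx]

lemma lintegral_shadow (i : ℕ) (j : LinkType) (x : Plane) (t : ℝ) (ε : ℝ≥0∞) (hε : ε ≤ 1) :
    ∫⁻ ω, (1 - {s | P.pathLoss j ‖x‖ s ≤ t}.indicator (fun _ => ε) (W.shadow j i ω)) ∂μ =
      1 - ε * P.lossCdf j t ‖x‖ := by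
  have hm : MeasurableSet {s | P.pathLoss j ‖x‖ s ≤ t} :=
    measurable_prodMk_left (P.measurableSet_pathLoss_le j t)
  have hmi : Measurable ({s | P.pathLoss j ‖x‖ s ≤ t}.indicator (fun _ => ε)) :=
    measurable_const.indicator hm
  have h := lintegral_one_sub (μ := μ) (hmi.comp (W.shadow_measurable j i))
    (fun ω => (indicator_le_self _ _ _).trans hε)
  simp only [Function.comp_apply] at h
  rw [h, ← lintegral_map hmi (W.shadow_measurable j i),
    lintegral_indicator_const hm, W.shadow_law, Params.lossCdf, Params.shadowLaw]

lemma lossCdf_le_one (P : Params) (j : LinkType) (t r : ℝ) : P.lossCdf j t r ≤ 1 := prob_le_one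

/-- The factor of a base station in the thinned void probability. -/
noncomputable def thinFactor (t : LinkType → ℝ) (ε : ℝ≥0∞) (i : ℕ) (ω : Ω) : ℝ≥0∞ :=
  1 - {ω | W.loss i ω ≤ t (W.linkType i ω)}.indicator (fun _ => ε) ω

omit [IsProbabilityMeasure μ] in
lemma measurableSet_loss_le (t : LinkType → ℝ) (i : ℕ) :
    MeasurableSet {ω | W.loss i ω ≤ t (W.linkType i ω)} :=
  measurableSet_le (W.measurable_loss i)
    (W.measurable_linkType_comp (q := fun j _ => t j) (fun _ => measurable_const) i)

lemma lintegral_prod_shadow (t : LinkType → ℝ) {ε : ℝ≥0∞} (hε : ε ≤ 1) (x : ℕ → Plane)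
    (j : ℕ → LinkType) (S : Finset ℕ) :
    ∫⁻ ω, ∏ i ∈ S, (1 - {s | P.pathLoss (j i) ‖x i‖ s ≤ t (j i)}.indicator (fun _ => ε)
      (W.shadow (j i) i ω)) ∂μ = ∏ i ∈ S, (1 - ε * P.lossCdf (j i) (t (j i)) ‖x i‖) := by
  have hmi : ∀ i, Measurable fun s : ℝ => (1 - {s | P.pathLoss (j i) ‖x i‖ s ≤
      t (j i)}.indicator (fun _ => ε) s) := fun i =>
    measurable_const.sub (measurable_const.indicator
      (measurable_prodMk_left (P.measurableSet_pathLoss_le (j i) (t (j i)))))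
  have hi : iIndepFun (fun i => W.shadow (j i) i) μ :=
    W.shadow_indep.precomp (g := fun i => (j i, i)) (fun a b h => (Prod.ext_iff.1 h).2)
  have h := lintegral_prod_eq_prod_lintegral_of_indepFun S _ (hi.comp _ hmi)
      (fun i => (hmi i).comp (W.shadow_measurable _ i))
  simp only [Function.comp_apply] at h
  rw [h]
  exact Finset.prod_congr rfl fun i _ => W.lintegral_shadow i (j i) (x i) (t (j i)) ε hε

omit [IsProbabilityMeasure μ] in
lemma lintegral_prod_typeOf (g : ℕ → LinkType → ℝ≥0∞) (x : ℕ → Plane) (S : Finset ℕ) :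
    ∫⁻ ω, ∏ i ∈ S, g i (P.typeOf (x i) (W.unblocked i ω)) ∂μ =
      ∏ i ∈ S, ∫⁻ ω, g i (P.typeOf (x i) (W.unblocked i ω)) ∂μ := by
  have hu : ∀ i, Measurable fun b : Bool => g i (P.typeOf (x i) b) := fun i => .of_discrete
  have h := lintegral_prod_eq_prod_lintegral_of_indepFun S _ (W.unblocked_indep.comp _ hu)
    (fun i => (hu i).comp (W.unblocked_measurable i))
  simpa only [Function.comp_apply] using h

lemma lintegral_one_sub_typeOf {g : LinkType → ℝ≥0∞} (hg : ∀ j, g j ≤ 1) {ε : ℝ≥0∞} (hε : ε ≤ 1)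
    (i : ℕ) (x : Plane) : ∫⁻ ω, (1 - ε * g (P.typeOf x (W.unblocked i ω))) ∂μ =
      1 - ε * (P.typeProb .los ‖x‖ * g .los + P.typeProb .nlos ‖x‖ * g .nlos) := by
  have hu : Measurable fun b : Bool => ε * g (P.typeOf x b) := .of_discrete
  have h := lintegral_one_sub (μ := μ) (hu.comp (W.unblocked_measurable i))
    (fun ω => mul_le_one' hε (hg _))
  simp only [Function.comp_apply] at h
  rw [h, lintegral_const_mul' _ _ (hε.trans_lt ENNReal.one_lt_top).ne, W.lintegral_typeOf i x g]

/-- The factor of base station `i` in the thinned void probability if its link has type `j`. -/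
noncomputable def typedFactor (P : Params) (t : LinkType → ℝ) (ε : ℝ≥0∞) (i : ℕ) (j : LinkType)
    (c : Params.Config) : ℝ≥0∞ :=
  1 - {s | P.pathLoss j ‖c.1 i‖ s ≤ t j}.indicator (fun _ => ε) (c.2.2 j i)

lemma measurable_typedFactor (P : Params) (t : LinkType → ℝ) (ε : ℝ≥0∞) (i : ℕ) (j : LinkType) :
    Measurable (typedFactor P t ε i j) := by
  refine measurable_const.sub (Measurable.indicator (s := {c : Params.Config |
    P.pathLoss j ‖c.1 i‖ (c.2.2 j i) ≤ t j}) (f := fun _ => ε) measurable_const ?_)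
  exact measurableSet_le (P.measurable_pathLoss_config j i) measurable_const

/-- The thinned void probability given the configuration. -/
noncomputable def thinProd (P : Params) (t : LinkType → ℝ) (ε : ℝ≥0∞) (m : ℕ)
    (c : Params.Config) : ℝ≥0∞ :=
  ∏ i ∈ Finset.range m, typedFactor P t ε i (P.configType i c) c

lemma measurable_thinProd (P : Params) (t : LinkType → ℝ) (ε : ℝ≥0∞) (m : ℕ) :
    Measurable (thinProd P t ε m) :=
  Finset.measurable_fun_prod _ fun i _ =>
    P.measurable_configType_comp (fun j => measurable_typedFactor P t ε i j) i

omit [IsProbabilityMeasure μ] in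
lemma prod_thinFactor (t : LinkType → ℝ) (ε : ℝ≥0∞) (m : ℕ) (ω : Ω) :
    ∏ i ∈ Finset.range m, W.thinFactor t ε i ω = thinProd P t ε m (W.config ω) := by
  refine Finset.prod_congr rfl fun i _ => ?_
  simp only [thinFactor, typedFactor, indicator, mem_ofPred_eq, loss_eq, linkType_eq,
    Params.configLoss]

lemma lintegral_thinProd (t : LinkType → ℝ) (ε : ℝ≥0∞) (m : ℕ) :
    ∫⁻ ω, thinProd P t ε m (W.config ω) ∂μ = ∫⁻ ω₁, ∫⁻ ω₂, ∫⁻ ω₃, thinProd P t ε m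
      (fun i => W.loc i ω₁, fun i => W.unblocked i ω₂, fun j i => W.shadow j i ω₃) ∂μ ∂μ ∂μ := by
  have hF := measurable_thinProd P t ε m
  have h1 : IndepFun (fun ω i => W.loc i ω)
      (fun ω => (fun i => W.unblocked i ω, fun j i => W.shadow j i ω)) μ :=
    W.indep_loc.comp measurable_id (measurable_fst.prodMk (measurable_fst.comp measurable_snd))
  have h2 : IndepFun (fun ω i => W.unblocked i ω) (fun ω j i => W.shadow j i ω) μ :=
    W.indep_unblocked.comp measurable_id measurable_fst
  have e1 := lintegral_indepFun W.measurable_locs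
    (W.measurable_unblockeds.prodMk W.measurable_shadows) h1
    (F := fun x z => thinProd P t ε m (x, z)) hF
  refine e1.trans (lintegral_congr fun ω₁ => ?_)
  exact lintegral_indepFun W.measurable_unblockeds W.measurable_shadows h2
    (F := fun u s => thinProd P t ε m (fun i => W.loc i ω₁, u, s))
    (hF.comp measurable_prodMk_left)

/-- With the locations frozen, the shadowings and then the blockages are integrated out.
Independence across stations lets each integral pass through the product, leaving a function of the
locations alone. -/
lemma lintegral_prod_thinFactor (t : LinkType → ℝ) {ε : ℝ≥0∞} (hε : ε ≤ 1) (m : ℕ) :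
    ∫⁻ ω, ∏ i ∈ Finset.range m, W.thinFactor t ε i ω ∂μ =
      ∫⁻ ω, ∏ i ∈ Finset.range m, (1 - ε * (P.typeProb .los ‖W.loc i ω‖ *
        P.lossCdf .los (t .los) ‖W.loc i ω‖ + P.typeProb .nlos ‖W.loc i ω‖ *
        P.lossCdf .nlos (t .nlos) ‖W.loc i ω‖)) ∂μ := by
  simp_rw [W.prod_thinFactor]
  rw [W.lintegral_thinProd]
  refine lintegral_congr fun ω₁ => ?_
  have e3 : ∀ ω₂, ∫⁻ ω₃, thinProd P t ε m (fun i => W.loc i ω₁, fun i => W.unblocked i ω₂,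
      fun j i => W.shadow j i ω₃) ∂μ = ∏ i ∈ Finset.range m, (1 - ε *
        P.lossCdf (P.typeOf (W.loc i ω₁) (W.unblocked i ω₂))
          (t (P.typeOf (W.loc i ω₁) (W.unblocked i ω₂))) ‖W.loc i ω₁‖) := fun ω₂ =>
    W.lintegral_prod_shadow t hε (fun i => W.loc i ω₁)
      (fun i => P.typeOf (W.loc i ω₁) (W.unblocked i ω₂)) _
  simp_rw [e3]
  rw [W.lintegral_prod_typeOf (fun i j => 1 - ε * P.lossCdf j (t j) ‖W.loc i ω₁‖)
    (fun i => W.loc i ω₁)]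
  exact Finset.prod_congr rfl fun i _ => W.lintegral_one_sub_typeOf
    (g := fun j => P.lossCdf j (t j) ‖W.loc i ω₁‖) (fun j => lossCdf_le_one _ _ _ _) hε i _

lemma typeProb_sum (P : Params) (r : ℝ) : P.typeProb .los r + P.typeProb .nlos r = 1 := by
  have : (Iic P.D).indicator (fun _ => ENNReal.ofReal P.pLOS) r ≤ 1 :=
    (indicator_le_self _ _ _).trans (by simpa using P.pLOS_le_one)
  exact add_tsub_cancel_of_le this

/-- Using a separate threshold for each type makes the exponent a sum over types; this is the source
of their independence. -/
lemma iInf_lintegral_prod_thinFactor (t : LinkType → ℝ) {ε : ℝ≥0∞} (hε : ε ≤ 1) :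
    ⨅ m, ∫⁻ ω, ∏ i ∈ Finset.range m, W.thinFactor t ε i ω ∂μ =
      ENNReal.ofReal (Real.exp (-(ε.toReal * (P.lamBS * ((P.meanCount .los (t .los)).toReal +
        (P.meanCount .nlos (t .nlos)).toReal))))) := by
  have hεt : ε ≠ ∞ := (hε.trans_lt ENNReal.one_lt_top).ne
  have hm : ∀ j, Measurable fun x : Plane => P.typeProb j ‖x‖ * P.lossCdf j (t j) ‖x‖ := fun j =>
    ((P.measurable_typeProb j).comp measurable_norm).mul (P.measurable_lossCdf j (t j))
  have hint : ∫⁻ x, ε * (P.typeProb .los ‖x‖ * P.lossCdf .los (t .los) ‖x‖ +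
      P.typeProb .nlos ‖x‖ * P.lossCdf .nlos (t .nlos) ‖x‖)
      ∂(ENNReal.ofReal P.lamBS • (volume : Measure Plane)) = ENNReal.ofReal P.lamBS * (ε *
        (P.meanCount .los (t .los) + P.meanCount .nlos (t .nlos))) := by
    rw [lintegral_smul_measure, lintegral_const_mul' _ _ hεt, lintegral_add_left (hm .los)]
    rfl
  have h := W.loc_poisson.iInf_lintegral_prod (((hm .los).add (hm .nlos)).const_mul ε) ?_ ?_
  · simp only [Pi.add_apply] at h
    simp_rw [W.lintegral_prod_thinFactor t hε]
    rw [h, hint, ENNReal.toReal_mul, ENNReal.toReal_mul,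
      ENNReal.toReal_add (P.meanCount_ne_top _ _) (P.meanCount_ne_top _ _),
      ENNReal.toReal_ofReal P.lamBS_pos.le]
    congr 3
    ring
  · intro x
    refine mul_le_one' hε ?_
    rw [← typeProb_sum P ‖x‖]
    exact add_le_add (mul_le_of_le_one_right' (lossCdf_le_one _ _ _ _))
      (mul_le_of_le_one_right' (lossCdf_le_one _ _ _ _))
  · simp only [Pi.add_apply]
    rw [hint]
    exact ENNReal.mul_ne_top ENNReal.ofReal_ne_top (ENNReal.mul_ne_top hεt
      (ENNReal.add_ne_top.2 ⟨P.meanCount_ne_top _ _, P.meanCount_ne_top _ _⟩))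

omit [IsProbabilityMeasure μ] in
lemma measurable_thinFactor (t : LinkType → ℝ) (ε : ℝ≥0∞) (i : ℕ) :
    Measurable (W.thinFactor t ε i) :=
  measurable_const.sub (measurable_const.indicator (W.measurableSet_loss_le t i))

omit [IsProbabilityMeasure μ] in
lemma thinFactor_le_one (t : LinkType → ℝ) (ε : ℝ≥0∞) (i : ℕ) (ω : Ω) :
    W.thinFactor t ε i ω ≤ 1 := tsub_le_self

lemma lintegral_iInf_prod_thinFactor (t : LinkType → ℝ) {ε : ℝ≥0∞} (hε : ε ≤ 1) :
    ∫⁻ ω, ⨅ m, ∏ i ∈ Finset.range m, W.thinFactor t ε i ω ∂μ =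
      ENNReal.ofReal (Real.exp (-(ε.toReal * (P.lamBS * ((P.meanCount .los (t .los)).toReal +
        (P.meanCount .nlos (t .nlos)).toReal))))) := by
  rw [← W.iInf_lintegral_prod_thinFactor t hε]
  refine lintegral_iInf (fun m => Finset.measurable_fun_prod _ fun i _ =>
    W.measurable_thinFactor t ε i) (fun m m' h ω =>
      IsPoissonProcess.antitone_prod_range (fun i => W.thinFactor_le_one t ε i ω) h) ?_
  simp

end Network

/-- Any N elements of the set bound the infimum by (1 - ε)^N. -/
lemma iInf_prod_thin_of_infinite {B : Set ℕ} (hB : B.Infinite) {ε : ℝ≥0∞} (h0 : ε ≠ 0) :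
    ⨅ m, ∏ i ∈ Finset.range m, (1 - B.indicator (fun _ => ε) i) = 0 := by
  classical
  have h1 : 1 - ε < 1 := ENNReal.sub_lt_self ENNReal.one_ne_top one_ne_zero h0
  refine le_antisymm (ge_of_tendsto' (ENNReal.tendsto_pow_atTop_nhds_zero_of_lt_one h1)
    fun N => ?_) zero_le
  obtain ⟨T, hT, hcard⟩ := hB.exists_subset_card_eq N
  refine (iInf_le _ (T.sup id + 1)).trans ?_
  have hsub : T ⊆ Finset.range (T.sup id + 1) := fun i hi =>
    Finset.mem_range.2 (Nat.lt_succ_of_le (Finset.le_sup (f := id) hi))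
  refine (Finset.prod_le_prod_of_subset_of_le_one' hsub fun i _ _ => tsub_le_self).trans ?_
  rw [Finset.prod_congr rfl fun i hi => by rw [indicator_of_mem (hT hi)], Finset.prod_const, hcard]

lemma iInf_prod_one_sub_indicator (B : Set ℕ) [Decidable (∀ i, i ∉ B)] :
    ⨅ m, ∏ i ∈ Finset.range m, (1 - B.indicator (fun _ => (1 : ℝ≥0∞)) i) =
      if ∀ i, i ∉ B then 1 else 0 := by
  split_ifs with h
  · simp [h]
  · push Not at h
    obtain ⟨i, hi⟩ := h
    refine le_antisymm ((iInf_le _ (i + 1)).trans ?_) zero_le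
    rw [Finset.prod_range_succ, indicator_of_mem hi]
    simp

/-! ### Least path losses and the serving link -/

namespace Network

variable {P : Params} {Ω : Type*} [MeasurableSpace Ω] {μ : Measure Ω} (W : Network P μ)
  [IsProbabilityMeasure μ]

/-- The infinite thinned product vanishes where infinitely many losses lie below the threshold and
is at most 1 elsewhere. So finiteness has probability at least exp(-εc) for each ε = 1/(n+1), and
the limit is 1. -/
lemma ae_finite_loss_le_const (t : LinkType → ℝ) :
    ∀ᵐ ω ∂μ, {i | W.loss i ω ≤ t (W.linkType i ω)}.Finite := by
  set F := {ω | {i | W.loss i ω ≤ t (W.linkType i ω)}.Finite} with hF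
  have hFm : MeasurableSet F := by
    have h := (_root_.measurable_encard (α := ℕ)).comp (measurable_set_iff.2 fun i =>
      measurable_mem.2 (W.measurableSet_loss_le t i))
    have h' := h (measurableSet_singleton (⊤ : ℕ∞)).compl
    convert! h' using 1
    ext ω
    exact encard_ne_top_iff.symm
  refine (mem_ae_iff_prob_eq_one hFm).2 (le_antisymm prob_le_one ?_)
  set c := P.lamBS * ((P.meanCount .los (t .los)).toReal + (P.meanCount .nlos (t .nlos)).toReal)
  have hb : ∀ n : ℕ, ENNReal.ofReal (Real.exp (-((1 / ((n : ℝ) + 1)) * c))) ≤ μ F := by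
    intro n
    have hpos : (0 : ℝ) < 1 / ((n : ℝ) + 1) := by positivity
    have hle : 1 / ((n : ℝ) + 1) ≤ 1 := by
      rw [div_le_one (by positivity)]
      have : (0 : ℝ) ≤ n := by positivity
      linarith
    have hε : ENNReal.ofReal (1 / ((n : ℝ) + 1)) ≤ 1 := ENNReal.ofReal_le_one.2 hle
    have h := W.lintegral_iInf_prod_thinFactor t hε
    rw [ENNReal.toReal_ofReal hpos.le] at h
    rw [← h, ← lintegral_indicator_one hFm]
    refine lintegral_mono fun ω => ?_
    by_cases hω : ω ∈ F
    · rw [indicator_of_mem hω]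
      exact (iInf_le _ 0).trans (by simp)
    · rw [indicator_of_notMem hω]
      exact (iInf_prod_thin_of_infinite (B := {i | W.loss i ω ≤ t (W.linkType i ω)}) hω
        (ENNReal.ofReal_pos.2 hpos).ne').le
  have hl : Tendsto (fun n : ℕ => ENNReal.ofReal (Real.exp (-((1 / ((n : ℝ) + 1)) * c)))) atTop
      (𝓝 1) := by
    have h := ((tendsto_one_div_add_atTop_nhds_zero_nat (𝕜 := ℝ)).mul_const c).neg.rexp
    rw [zero_mul, neg_zero, Real.exp_zero] at h
    simpa using ENNReal.tendsto_ofReal h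
  exact le_of_tendsto' hl hb

lemma ae_finite_loss_le : ∀ᵐ ω ∂μ, ∀ T : ℝ, {i | W.loss i ω ≤ T}.Finite := by
  have h : ∀ n : ℕ, ∀ᵐ ω ∂μ, {i | W.loss i ω ≤ (n : ℝ)}.Finite := fun n =>
    W.ae_finite_loss_le_const fun _ => n
  filter_upwards [ae_all_iff.2 h] with ω hω T
  obtain ⟨n, hn⟩ := exists_nat_ge T
  exact (hω n).subset fun i hi => le_trans hi hn

open Classical in
/-- Least path loss among the links of type `j`. -/
noncomputable def leastLoss (j : LinkType) (ω : Ω) : ℝ≥0∞ :=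
  ⨅ i, if W.linkType i ω = j then ENNReal.ofReal (W.loss i ω) else ∞

omit [IsProbabilityMeasure μ] in
lemma measurable_leastLoss (j : LinkType) : Measurable (W.leastLoss j) := by
  classical
  refine Measurable.iInf fun i => ?_
  refine W.measurable_linkType_comp
    (q := fun j' ω => if j' = j then ENNReal.ofReal (W.loss i ω) else ∞) (fun j' => ?_) i
  by_cases h : j' = j
  · simpa [h] using (W.measurable_loss i).ennreal_ofReal
  · simp [h]

omit [IsProbabilityMeasure μ] in
lemma leastLoss_le {j : LinkType} {i : ℕ} {ω : Ω} (h : W.linkType i ω = j) :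
    W.leastLoss j ω ≤ ENNReal.ofReal (W.loss i ω) :=
  (iInf_le _ i).trans_eq (if_pos h)

omit [IsProbabilityMeasure μ] in
lemma le_leastLoss {j : LinkType} {ω : Ω} {a : ℝ≥0∞}
    (h : ∀ i, W.linkType i ω = j → a ≤ ENNReal.ofReal (W.loss i ω)) : a ≤ W.leastLoss j ω := by
  refine le_iInf fun i => ?_
  split_ifs with hi
  · exact h i hi
  · exact le_top

omit [IsProbabilityMeasure μ] in
-- A strict lower bound for every loss passes to the infimum because only finitely many losses
-- compete near it. The window s + 1 is arbitrary: if it contains no link of type j, the infimum is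
-- at least s + 1.
lemma lt_leastLoss_iff {ω : Ω} (hω : ∀ T : ℝ, {i | W.loss i ω ≤ T}.Finite) (j : LinkType)
    (s : ℝ≥0) : s < W.leastLoss j ω ↔ ∀ i, W.linkType i ω = j → (s : ℝ) < W.loss i ω := by
  constructor
  · intro h i hi
    have := h.trans_le (W.leastLoss_le hi)
    rw [← ENNReal.ofReal_coe_nnreal, ENNReal.ofReal_lt_ofReal_iff (W.loss_pos i ω)] at this
    exact this
  · intro h
    have hfin := (hω (s + 1)).inter_of_left {i | W.linkType i ω = j}
    rcases ({i | W.loss i ω ≤ s + 1} ∩ {i | W.linkType i ω = j}).eq_empty_or_nonempty with he | hne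
    · refine lt_of_lt_of_le (b := ENNReal.ofReal (s + 1)) ?_ (W.le_leastLoss fun i hi => ?_)
      · rw [← ENNReal.ofReal_coe_nnreal, ENNReal.ofReal_lt_ofReal_iff (by positivity)]
        linarith
      · refine ENNReal.ofReal_le_ofReal (le_of_not_ge fun hle => ?_)
        exact (he ▸ (⟨hle, hi⟩ : i ∈ {i | W.loss i ω ≤ s + 1} ∩ {i | W.linkType i ω = j}) :
          i ∈ (∅ : Set ℕ))
    · obtain ⟨i₀, hi₀, hmin⟩ := exists_min_image _ (fun i => W.loss i ω) hfin hne
      refine lt_of_lt_of_le (b := ENNReal.ofReal (W.loss i₀ ω)) ?_ (W.le_leastLoss fun i hi => ?_)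
      · rw [← ENNReal.ofReal_coe_nnreal, ENNReal.ofReal_lt_ofReal_iff (W.loss_pos _ _)]
        exact h i₀ hi₀.2
      · refine ENNReal.ofReal_le_ofReal ?_
        rcases le_or_gt (W.loss i ω) (s + 1) with hle | hlt
        · exact hmin i ⟨hle, hi⟩
        · exact hi₀.1.trans hlt.le

/-- At ε = 1 the infinite product is the indicator that no link lies at or below its threshold. -/
lemma measure_lt_leastLoss_and (s t : ℝ≥0) :
    μ {ω | s < W.leastLoss .los ω ∧ t < W.leastLoss .nlos ω} =
      ENNReal.ofReal (P.lossTail .los s) * ENNReal.ofReal (P.lossTail .nlos t) := by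
  classical
  let thr : LinkType → ℝ := fun j => match j with
    | .los => s
    | .nlos => t
  have hm : MeasurableSet {ω | s < W.leastLoss .los ω ∧ t < W.leastLoss .nlos ω} :=
    (measurableSet_lt measurable_const (W.measurable_leastLoss _)).inter
      (measurableSet_lt measurable_const (W.measurable_leastLoss _))
  have h := W.lintegral_iInf_prod_thinFactor thr le_rfl
  have he : ∀ᵐ ω ∂μ, {ω | s < W.leastLoss .los ω ∧ t < W.leastLoss .nlos ω}.indicator 1 ω =
      ⨅ m, ∏ i ∈ Finset.range m, W.thinFactor thr 1 i ω := by
    filter_upwards [W.ae_finite_loss_le] with ω hω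
    have h1 := iInf_prod_one_sub_indicator {i | W.loss i ω ≤ thr (W.linkType i ω)}
    refine Eq.trans ?_ h1.symm
    rw [indicator_apply]
    refine if_congr ?_ rfl rfl
    rw [mem_ofPred_eq, W.lt_leastLoss_iff hω, W.lt_leastLoss_iff hω]
    simp only [mem_ofPred_eq, not_le]
    constructor
    · rintro ⟨h1, h2⟩ i
      cases hi : W.linkType i ω
      · exact h1 i hi
      · exact h2 i hi
    · refine fun h => ⟨fun i hi => ?_, fun i hi => ?_⟩
      · simpa [hi, thr] using h i
      · simpa [hi, thr] using h i
  rw [← lintegral_indicator_one hm, lintegral_congr_ae he, h, Params.lossTail, Params.lossTail,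
    ← ENNReal.ofReal_mul (Real.exp_pos _).le, ← Real.exp_add]
  simp only [ENNReal.toReal_one, thr]
  congr 2
  ring

/-- This allows each marginal tail to be read off the joint tail with the other threshold set to 0.
-/
lemma ae_leastLoss_pos : ∀ᵐ ω ∂μ, 0 < W.leastLoss .los ω ∧ 0 < W.leastLoss .nlos ω := by
  have h := W.measure_lt_leastLoss_and 0 0
  rw [NNReal.coe_zero, P.lossTail_of_nonpos _ le_rfl, P.lossTail_of_nonpos _ le_rfl] at h
  simp only [ENNReal.coe_zero, ENNReal.ofReal_one, mul_one] at h
  exact (mem_ae_iff_prob_eq_one ((measurableSet_lt measurable_const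
    (W.measurable_leastLoss _)).inter (measurableSet_lt measurable_const
      (W.measurable_leastLoss _)))).2 h

lemma measure_lt_leastLoss (j : LinkType) (s : ℝ≥0) :
    μ {ω | s < W.leastLoss j ω} = ENNReal.ofReal (P.lossTail j s) := by
  cases j
  · have h := W.measure_lt_leastLoss_and s 0
    rw [NNReal.coe_zero, P.lossTail_of_nonpos _ le_rfl, ENNReal.ofReal_one, mul_one] at h
    rw [← h]
    refine measure_congr ?_
    filter_upwards [W.ae_leastLoss_pos] with ω hω
    exact propext (iff_self_and.2 fun _ => hω.2)
  · have h := W.measure_lt_leastLoss_and 0 s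
    rw [NNReal.coe_zero, P.lossTail_of_nonpos _ le_rfl, ENNReal.ofReal_one, one_mul] at h
    rw [← h]
    refine measure_congr ?_
    filter_upwards [W.ae_leastLoss_pos] with ω hω
    exact propext (iff_and_self.2 fun _ => hω.1)

lemma indepFun_leastLoss (j : LinkType) :
    IndepFun (W.leastLoss j) (W.leastLoss j.other) μ := by
  have h : IndepFun (W.leastLoss .los) (W.leastLoss .nlos) μ :=
    indepFun_of_tail (W.measurable_leastLoss _) (W.measurable_leastLoss _) fun s t => by
      rw [W.measure_lt_leastLoss_and, W.measure_lt_leastLoss, W.measure_lt_leastLoss]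
  cases j
  · exact h
  · exact h.symm

/-- On the event that there is a link of type `j`, the least path loss has density
`lossDensity`. -/
lemma map_leastLoss (j : LinkType) :
    (μ.restrict {ω | W.leastLoss j ω < ∞}).map (fun ω => (W.leastLoss j ω).toReal) =
      (volume.restrict (Ioi 0)).withDensity fun l => ENNReal.ofReal (P.lossDensity j l) := by
  have hm : Measurable fun ω => (W.leastLoss j ω).toReal := (W.measurable_leastLoss j).ennreal_toReal
  have hms : MeasurableSet {ω | W.leastLoss j ω < ∞} :=
    measurableSet_lt (W.measurable_leastLoss j) measurable_const
  refine Measure.ext_of_Iic _ _ fun a => ?_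
  rw [Measure.map_apply hm measurableSet_Iic, Measure.restrict_apply (hm measurableSet_Iic),
    withDensity_apply _ measurableSet_Iic, Measure.restrict_restrict measurableSet_Iic,
    inter_comm (Iic a), Ioi_inter_Iic]
  rcases lt_or_ge a 0 with ha | ha
  · rw [Ioc_eq_empty (not_lt.2 ha.le), Measure.restrict_empty, lintegral_zero_measure]
    convert! measure_empty (μ := μ)
    ext ω
    simp only [mem_inter_iff, mem_preimage, mem_Iic, mem_empty_iff_false, iff_false, not_and]
    intro h
    exact absurd (h.trans_lt ha) (not_lt.2 ENNReal.toReal_nonneg)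
  · rw [P.setLIntegral_lossDensity j ha]
    lift a to ℝ≥0 using ha
    have hc : ((fun ω => (W.leastLoss j ω).toReal) ⁻¹' Iic (a : ℝ) ∩ {ω | W.leastLoss j ω < ∞}) =
        {ω | a < W.leastLoss j ω}ᶜ := by
      ext ω
      simp only [mem_inter_iff, mem_preimage, mem_Iic, mem_ofPred_eq, mem_compl_iff, not_lt]
      constructor
      · rintro ⟨h1, h2⟩
        rw [← ENNReal.ofReal_toReal h2.ne, ← ENNReal.ofReal_coe_nnreal]
        exact ENNReal.ofReal_le_ofReal h1
      · intro h
        have h2 := h.trans_lt ENNReal.coe_lt_top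
        exact ⟨ENNReal.toReal_mono ENNReal.coe_ne_top h, h2⟩
    rw [hc, prob_compl_eq_one_sub (measurableSet_lt measurable_const (W.measurable_leastLoss j)),
      W.measure_lt_leastLoss]

lemma lintegral_leastLoss (j : LinkType) {H : ℝ → ℝ≥0∞} (hH : Measurable H) :
    ∫⁻ ω in {ω | W.leastLoss j ω < ∞}, H (W.leastLoss j ω).toReal ∂μ =
      ∫⁻ l in Ioi 0, ENNReal.ofReal (P.lossDensity j l) * H l := by
  rw [← lintegral_map hH (W.measurable_leastLoss j).ennreal_toReal, W.map_leastLoss,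
    lintegral_withDensity_eq_lintegral_mul₀' _ hH.aemeasurable]
  · rfl
  · exact (P.integrableOn_lossDensity j).aemeasurable.ennreal_ofReal

lemma measure_leastLoss_eq (j : LinkType) {x : ℝ≥0∞} (hx : x < ∞) :
    μ {ω | W.leastLoss j ω = x} = 0 := by
  have h : (volume.restrict (Ioi 0)).withDensity (fun l => ENNReal.ofReal (P.lossDensity j l))
      {x.toReal} = 0 := by
    refine withDensity_absolutelyContinuous _ _ ?_
    simp
  rw [← W.map_leastLoss, Measure.map_apply (W.measurable_leastLoss j).ennreal_toReal
    (measurableSet_singleton _), Measure.restrict_apply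
    ((W.measurable_leastLoss j).ennreal_toReal (measurableSet_singleton _))] at h
  refine measure_mono_null (fun ω hω => ?_) h
  have hω : W.leastLoss j ω = x := hω
  exact ⟨by simp [hω], by simpa [hω] using hx⟩

/-- By independence one value may be frozen, and the other law has no finite atom. Infinity is
exempt, since a type may have no link at all. -/
lemma ae_leastLoss_ne (j : LinkType) :
    ∀ᵐ ω ∂μ, W.leastLoss j ω < ∞ → W.leastLoss j ω ≠ W.leastLoss j.other ω := by
  have hs : MeasurableSet {z : ℝ≥0∞ × ℝ≥0∞ | z.1 < ∞ ∧ z.2 = z.1} :=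
    (measurableSet_lt measurable_fst measurable_const).inter
      (measurableSet_eq_fun measurable_snd measurable_fst)
  have h := lintegral_indepFun (W.measurable_leastLoss j) (W.measurable_leastLoss j.other)
    (W.indepFun_leastLoss j)
    (F := fun x y => {z : ℝ≥0∞ × ℝ≥0∞ | z.1 < ∞ ∧ z.2 = z.1}.indicator 1 (x, y))
    (measurable_one.indicator hs)
  have h0 : ∀ x : ℝ≥0∞, ∫⁻ ω, {z : ℝ≥0∞ × ℝ≥0∞ | z.1 < ∞ ∧ z.2 = z.1}.indicator 1
      (x, W.leastLoss j.other ω) ∂μ = 0 := by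
    intro x
    rcases eq_or_ne x ∞ with rfl | hx
    · simp
    · have h1 := W.measure_leastLoss_eq j.other hx.lt_top
      have hm : MeasurableSet {ω | W.leastLoss j.other ω = x} :=
        W.measurable_leastLoss _ (measurableSet_singleton _)
      rw [← h1, ← lintegral_indicator_one hm]
      refine lintegral_congr fun ω => ?_
      simp [indicator, hx.lt_top]
  simp only [h0, lintegral_zero] at h
  have h' := (lintegral_eq_zero_iff ((measurable_one.indicator hs).comp
    ((W.measurable_leastLoss j).prodMk (W.measurable_leastLoss j.other)))).1 h
  filter_upwards [h'] with ω hω hlt heq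
  simp [indicator, hlt, heq.symm] at hω

omit [IsProbabilityMeasure μ] in
lemma loss_tagged_le {ω : Ω} (hω : ∀ T : ℝ, {i | W.loss i ω ≤ T}.Finite) (k : ℕ) :
    W.loss (W.tagged ω) ω ≤ W.loss k ω := by
  have hne : {i | ∀ k, W.loss i ω ≤ W.loss k ω}.Nonempty := by
    -- Only stations at least as good as station 0 compete, and they are finitely many.
    obtain ⟨i, hi, hmin⟩ := exists_min_image _ (fun i => W.loss i ω) (hω (W.loss 0 ω))
      ⟨0, le_refl (W.loss 0 ω)⟩
    refine ⟨i, fun k => ?_⟩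
    rcases le_or_gt (W.loss k ω) (W.loss 0 ω) with h | h
    · exact hmin k h
    · exact hi.trans h.le
  exact Nat.sInf_mem hne k

/-- The serving loss bounds both least losses from below and equals that of its own type; absence of
ties makes the comparison strict. -/
lemma ae_servingType_iff (j : LinkType) : ∀ᵐ ω ∂μ,
    (W.servingType ω = j ↔ W.leastLoss j ω < W.leastLoss j.other ω) ∧
      (W.servingType ω = j → W.leastLoss j ω = ENNReal.ofReal (W.loss (W.tagged ω) ω)) := by
  filter_upwards [W.ae_finite_loss_le, W.ae_leastLoss_ne j, W.ae_leastLoss_ne j.other]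
    with ω hω hne hne'
  have hle := W.loss_tagged_le hω
  have h1 : ∀ j, ENNReal.ofReal (W.loss (W.tagged ω) ω) ≤ W.leastLoss j ω := fun j =>
    W.le_leastLoss fun i _ => ENNReal.ofReal_le_ofReal (hle i)
  have h2 : ∀ j, W.servingType ω = j →
      W.leastLoss j ω = ENNReal.ofReal (W.loss (W.tagged ω) ω) := fun j hj =>
    le_antisymm (W.leastLoss_le hj) (h1 j)
  refine ⟨⟨fun hj => ?_, fun hlt => ?_⟩, h2 j⟩
  · have h3 := h2 j hj
    refine lt_of_le_of_ne (h3.trans_le (h1 _)) (hne ?_)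
    rw [h3]; exact ENNReal.ofReal_lt_top
  · by_contra hj
    have hj' : W.servingType ω = j.other := by
      revert hj
      cases W.servingType ω <;> cases j <;> simp [LinkType.other]
    have h3 := h2 _ hj'
    exact absurd hlt (not_lt.2 (h3.trans_le (h1 _)))

/-- Joint law of the type and the path loss of the serving link. -/
lemma lintegral_serving (j : LinkType) {H : ℝ → ℝ≥0∞} (hH : Measurable H) :
    ∫⁻ ω, {ω | W.servingType ω = j}.indicator (fun ω => H (W.loss (W.tagged ω) ω)) ω ∂μ =
      ∫⁻ l in Ioi 0, H l * ENNReal.ofReal (P.lossTail j.other l * P.lossDensity j l) := by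
  have h1 : ∀ᵐ ω ∂μ, {ω | W.servingType ω = j}.indicator (fun ω => H (W.loss (W.tagged ω) ω)) ω =
      {z : ℝ≥0∞ × ℝ≥0∞ | z.1 < z.2}.indicator (fun z => H z.1.toReal)
        (W.leastLoss j ω, W.leastLoss j.other ω) := by
    filter_upwards [W.ae_servingType_iff j] with ω hω
    by_cases h : W.servingType ω = j
    · rw [indicator_of_mem (by exact h), indicator_of_mem (by exact hω.1.1 h), hω.2 h,
        ENNReal.toReal_ofReal (W.loss_pos _ _).le]
    · rw [indicator_of_notMem (by exact h), indicator_of_notMem (by exact fun h' => h (hω.1.2 h'))]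
  have hs : MeasurableSet {z : ℝ≥0∞ × ℝ≥0∞ | z.1 < z.2} :=
    measurableSet_lt measurable_fst measurable_snd
  have hHm : Measurable fun z : ℝ≥0∞ × ℝ≥0∞ => H z.1.toReal :=
    hH.comp measurable_fst.ennreal_toReal
  rw [lintegral_congr_ae h1, lintegral_indepFun (W.measurable_leastLoss j)
    (W.measurable_leastLoss j.other) (W.indepFun_leastLoss j)
    (F := fun x y => {z : ℝ≥0∞ × ℝ≥0∞ | z.1 < z.2}.indicator (fun z => H z.1.toReal) (x, y))
    (hHm.indicator hs)]
  -- Integrating out the other type leaves its tail at x. The value x = ∞ contributes nothing, as no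
  -- loss exceeds it.
  have h2 : ∀ x : ℝ≥0∞, ∫⁻ ω, {z : ℝ≥0∞ × ℝ≥0∞ | z.1 < z.2}.indicator (fun z => H z.1.toReal)
      (x, W.leastLoss j.other ω) ∂μ = (Iio ∞).indicator (fun x => H x.toReal *
        ENNReal.ofReal (P.lossTail j.other x.toReal)) x := by
    intro x
    rcases eq_or_ne x ∞ with rfl | hx
    · simp [indicator]
    · have hm : MeasurableSet {ω | x < W.leastLoss j.other ω} :=
        measurableSet_lt measurable_const (W.measurable_leastLoss _)
      rw [indicator_of_mem (by exact hx.lt_top)]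
      lift x to ℝ≥0 using hx
      have h3 := W.measure_lt_leastLoss j.other x
      rw [ENNReal.coe_toReal, ← h3, ← lintegral_indicator_const hm]
      rfl
  simp_rw [h2]
  have h3 := lintegral_indicator (μ := μ) (s := {ω | W.leastLoss j ω < ∞})
    (measurableSet_lt (W.measurable_leastLoss j) measurable_const) (fun ω => H (W.leastLoss j ω).toReal *
        ENNReal.ofReal (P.lossTail j.other (W.leastLoss j ω).toReal))
  refine Eq.trans ?_ (h3.trans ?_)
  · rfl
  · rw [W.lintegral_leastLoss j (H := fun l => H l * ENNReal.ofReal (P.lossTail j.other l))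
      (hH.mul (P.antitone_lossTail _).measurable.ennreal_ofReal)]
    refine lintegral_congr fun l => ?_
    rw [ENNReal.ofReal_mul (P.lossTail_pos _ _).le]
    ring

end Network

/-! ### Measurability of the serving index -/

/-- The second alternative is the default `sInf ∅ = 0`. Keeping it makes the events for the serving
index measurable on the whole space, not only where a minimum exists. -/
lemma sInf_nat_eq_iff {S : Set ℕ} {i : ℕ} :
    sInf S = i ↔ (i ∈ S ∧ ∀ k < i, k ∉ S) ∨ (i = 0 ∧ ∀ k, k ∉ S) := by
  constructor
  · rintro rfl
    rcases S.eq_empty_or_nonempty with rfl | hne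
    · right; simp
    · exact Or.inl ⟨Nat.sInf_mem hne, fun k hk => Nat.notMem_of_lt_sInf hk⟩
  · rintro (⟨hi, hk⟩ | ⟨rfl, hk⟩)
    · refine le_antisymm (Nat.sInf_le hi) (not_lt.1 fun hlt => hk _ hlt (Nat.sInf_mem ⟨i, hi⟩))
    · rw [eq_empty_of_forall_notMem hk, Nat.sInf_empty]

namespace Params

variable (P : Params)

/-- Index of the serving base station in a configuration. -/
noncomputable def configTagged (c : Config) : ℕ :=
  sInf {i | ∀ k, P.configLoss i c ≤ P.configLoss k c}

lemma measurableSet_configTagged (i : ℕ) : MeasurableSet {c | P.configTagged c = i} := by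
  have hm : ∀ i, MeasurableSet {c | ∀ k, P.configLoss i c ≤ P.configLoss k c} := fun i => by
    rw [ofPred_forall]
    exact MeasurableSet.iInter fun k =>
      measurableSet_le (P.measurable_configLoss i) (P.measurable_configLoss k)
  have he : {c | P.configTagged c = i} = ({c | ∀ k, P.configLoss i c ≤ P.configLoss k c} ∩
      ⋂ k, ⋂ _ : k < i, {c | ∀ l, P.configLoss k c ≤ P.configLoss l c}ᶜ) ∪
      ({_c | i = 0} ∩ ⋂ k, {c | ∀ l, P.configLoss k c ≤ P.configLoss l c}ᶜ) := by
    ext c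
    simp only [configTagged, mem_ofPred_eq, sInf_nat_eq_iff, mem_union, mem_inter_iff, mem_iInter,
      mem_compl_iff]
  rw [he]
  exact ((hm i).inter (MeasurableSet.iInter fun k => MeasurableSet.iInter fun _ =>
    (hm k).compl)).union ((MeasurableSet.const _).inter (MeasurableSet.iInter fun k =>
      (hm k).compl))

end Params

/-! ### Coverage events and the rate -/

namespace Network

variable {P : Params} {Ω : Type*} [MeasurableSpace Ω] {μ : Measure Ω} (W : Network P μ)

/-- Gains, zero-forcing penalties and load. -/
def marks (ω : Ω) : (ℕ → ℕ → ℂ) × (LinkType → ℕ → ℝ) × ℕ :=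
  (fun i k => W.fading i k ω, fun j U => W.zf j U ω, W.load ω)

lemma measurable_fadings : Measurable fun ω i k => W.fading i k ω :=
  measurable_pi_lambda _ fun i => measurable_pi_lambda _ (W.fading_measurable i)

lemma measurable_zfs : Measurable fun ω j U => W.zf j U ω :=
  measurable_pi_lambda _ fun j => measurable_pi_lambda _ (W.zf_measurable j)

lemma measurable_marks : Measurable W.marks :=
  W.measurable_fadings.prodMk (W.measurable_zfs.prodMk W.load_measurable)

lemma tagged_eq (ω : Ω) : W.tagged ω = P.configTagged (W.config ω) := by
  simp only [tagged, Params.configTagged, loss_eq]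

variable [IsProbabilityMeasure μ]

/-- The configuration determines the serving index and link type, so freezing it turns the serving
gains into gains of a fixed station. -/
lemma indepFun_config_marks : IndepFun W.config W.marks μ := by
  have h1 : IndepFun (fun ω => (fun i => W.unblocked i ω, fun j i => W.shadow j i ω))
      W.marks μ :=
    indepFun_prodMk_left W.measurable_unblockeds W.measurable_shadows W.measurable_marks
      W.indep_unblocked W.indep_shadow
  refine indepFun_prodMk_left W.measurable_locs
    (W.measurable_unblockeds.prodMk W.measurable_shadows) W.measurable_marks ?_ h1
  exact W.indep_loc.comp (ψ := fun z => ((z.1, z.2.1), z.2.2)) measurable_id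
    ((measurable_fst.prodMk (measurable_fst.comp measurable_snd)).prodMk
      (measurable_snd.comp measurable_snd))

/-- Complement of the event that all N independent exponential powers stay at or below x. -/
lemma measure_lt_iSup_fading (i : ℕ) {N : ℕ} (hN : 0 < N) {x : ℝ} (hx : 0 ≤ x) :
    μ {ω | x < ⨆ k : Fin N, ‖W.fading i k ω‖ ^ 2} = ENNReal.ofReal (Params.fadingTail N x) := by
  have : Nonempty (Fin N) := ⟨⟨0, hN⟩⟩
  have hlt : MeasurableSet {z : ℂ | x < ‖z‖ ^ 2} := measurableSet_lt measurable_const (by fun_prop)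
  have he : {ω | x < ⨆ k : Fin N, ‖W.fading i k ω‖ ^ 2} =
      (⋂ k ∈ (Finset.univ : Finset (Fin N)), W.fading i k ⁻¹' {z : ℂ | x < ‖z‖ ^ 2}ᶜ)ᶜ := by
    rw [← compl_inj_iff, compl_compl]
    ext ω
    simp only [mem_compl_iff, mem_ofPred_eq, not_lt, Finset.mem_univ, iInter_true, mem_iInter,
      mem_preimage]
    exact ciSup_le_iff (finite_range _).bddAbove
  have hi : iIndepFun (fun k : Fin N => W.fading i k) μ :=
    W.fading_indep.precomp (g := fun k : Fin N => (i, (k : ℕ)))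
      (fun a b h => Fin.ext (Prod.ext_iff.1 h).2)
  have hm : MeasurableSet (⋂ k ∈ (Finset.univ : Finset (Fin N)),
      W.fading i k ⁻¹' {z : ℂ | x < ‖z‖ ^ 2}ᶜ) :=
    Finset.measurableSet_biInter _ fun k _ => W.fading_measurable i k hlt.compl
  have h1 : ∀ k, μ (W.fading i k ⁻¹' {z : ℂ | x < ‖z‖ ^ 2}ᶜ) =
      ENNReal.ofReal (1 - Real.exp (-x)) := fun k => by
    rw [preimage_compl, prob_compl_eq_one_sub (W.fading_measurable i k hlt),
      ← Measure.map_apply (W.fading_measurable i k) hlt, W.fading_law,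
      complexNormal_lt_norm_sq hx, ← ENNReal.ofReal_one,
      ENNReal.ofReal_sub _ (Real.exp_pos _).le]
  have h2 : 0 ≤ 1 - Real.exp (-x) := by
    rw [sub_nonneg, Real.exp_le_one_iff, neg_nonpos]; exact hx
  rw [he, prob_compl_eq_one_sub hm, hi.measure_inter_preimage_eq_mul _ fun k _ => hlt.compl]
  simp only [h1, Finset.prod_const, Finset.card_univ, Fintype.card_fin]
  rw [Params.fadingTail, ENNReal.ofReal_sub 1 (pow_nonneg h2 N), ENNReal.ofReal_one,
    ENNReal.ofReal_pow h2]

omit [IsProbabilityMeasure μ] in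
lemma kappa_nonneg (W : Network P μ) (n : ℕ) : 0 ≤ P.kappa n := W.load_law n ▸ measureReal_nonneg

omit [IsProbabilityMeasure μ] in
-- The sign is taken from the network, where ζ is the probability of a penalty equal to 1, and not
-- from the formula.
lemma zeta_nonneg (W : Network P μ) (j : LinkType) {U : ℕ} (hU : 1 ≤ U) : 0 ≤ P.zeta (P.η j) U :=
  W.zf_law j U hU ▸ measureReal_nonneg

/-- Events of the marks that give a coverage at station `i` with a link of type `j`. -/
def markSet (P : Params) (i : ℕ) (j : LinkType) (x : ℝ) (U n : ℕ) :
    Set ((ℕ → ℕ → ℂ) × (LinkType → ℕ → ℝ) × ℕ) :=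
  {z | x < ⨆ k : Fin (P.η j), ‖z.1 i k‖ ^ 2} ∩ ({z | z.2.1 j U = 1} ∩ {z | z.2.2 = n})

lemma measure_markSet (i : ℕ) (j : LinkType) {x : ℝ} (hx : 0 ≤ x) {U : ℕ} (hU : 1 ≤ U) (n : ℕ) :
    μ {ω | W.marks ω ∈ markSet P i j x U n} =
      ENNReal.ofReal (Params.fadingTail (P.η j) x) *
        (ENNReal.ofReal (P.zeta (P.η j) U) * ENNReal.ofReal (P.kappa n)) := by
  have h1 : MeasurableSet {z : ℕ → ℕ → ℂ | x < ⨆ k : Fin (P.η j), ‖z i k‖ ^ 2} :=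
    measurableSet_lt measurable_const (Measurable.iSup fun k => by fun_prop)
  have h2 : MeasurableSet {z : LinkType → ℕ → ℝ | z j U = 1} := by
    have : Measurable fun z : LinkType → ℕ → ℝ => z j U := by fun_prop
    exact this (measurableSet_singleton 1)
  have h3 : MeasurableSet {m : ℕ | m = n} := measurableSet_singleton n
  have e1 := W.indep_fading.measure_inter_preimage_eq_mul _ ({z : LinkType → ℕ → ℝ | z j U = 1} ×ˢ
    {m : ℕ | m = n}) h1 (h2.prod h3)
  have e2 := W.indep_zf.measure_inter_preimage_eq_mul _ _ h2 h3
  rw [← W.measure_lt_iSup_fading i (P.η_pos j) hx, ← W.zf_law j U hU, ← W.load_law n,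
    ofReal_measureReal, ofReal_measureReal]
  refine Eq.trans e1 ?_
  congr 1

lemma measurableSet_markSet (i : ℕ) (j : LinkType) {f : Params.Config → ℝ} (hf : Measurable f)
    (U n : ℕ) : MeasurableSet {z : Params.Config × ((ℕ → ℕ → ℂ) × (LinkType → ℕ → ℝ) × ℕ) |
      z.2 ∈ markSet P i j (f z.1) U n} := by
  refine MeasurableSet.inter ?_ (MeasurableSet.inter ?_ ?_)
  · refine measurableSet_lt (hf.comp measurable_fst) (Measurable.iSup fun k => ?_)
    have : Measurable fun z : Params.Config × ((ℕ → ℕ → ℂ) × (LinkType → ℕ → ℝ) × ℕ) =>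
        z.2.1 i k := by fun_prop
    exact this.norm.pow_const 2
  · have : Measurable fun z : Params.Config × ((ℕ → ℕ → ℂ) × (LinkType → ℕ → ℝ) × ℕ) =>
        z.2.2.1 j U := by fun_prop
    exact this (measurableSet_singleton 1)
  · have : Measurable fun z : Params.Config × ((ℕ → ℕ → ℂ) × (LinkType → ℕ → ℝ) × ℕ) =>
        z.2.2.2 := by fun_prop
    exact this (measurableSet_singleton n)

/-- Coverage event at load `n`, for a serving link of type `j` to station `i`. -/
def coverAt (a : ℝ) (U n : ℕ) (j : LinkType) (i : ℕ) : Set Ω :=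
  {ω | (W.tagged ω = i ∧ W.linkType i ω = j) ∧ W.marks ω ∈ markSet P i j (a * W.loss i ω) U n}

/-- Coverage event at load `n`, for a serving link of type `j`. -/
def cover (a : ℝ) (U n : ℕ) (j : LinkType) : Set Ω :=
  {ω | W.servingType ω = j ∧ a * W.loss (W.tagged ω) ω < W.bestFading ω ∧
    W.zf (W.servingType ω) U ω = 1 ∧ W.load ω = n}

omit [IsProbabilityMeasure μ] in
-- Splitting by serving index replaces the random station by a deterministic one, to which
-- independence of the marks applies.
lemma cover_eq_iUnion (a : ℝ) (U n : ℕ) (j : LinkType) :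
    W.cover a U n j = ⋃ i, W.coverAt a U n j i := by
  ext ω
  simp only [cover, coverAt, mem_ofPred_eq, mem_iUnion]
  constructor
  · rintro ⟨rfl, h1, h2, h3⟩
    exact ⟨W.tagged ω, ⟨rfl, rfl⟩, h1, h2, h3⟩
  · rintro ⟨i, ⟨rfl, rfl⟩, h1, h2, h3⟩
    exact ⟨rfl, h1, h2, h3⟩

omit [IsProbabilityMeasure μ] in
lemma measurableSet_taggedType (j : LinkType) (i : ℕ) :
    MeasurableSet {c | P.configTagged c = i ∧ P.configType i c = j} :=
  (P.measurableSet_configTagged i).inter (P.measurableSet_configType i j)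

omit [IsProbabilityMeasure μ] in
lemma measurableSet_coverAt (a : ℝ) (U n : ℕ) (j : LinkType) (i : ℕ) :
    MeasurableSet (W.coverAt a U n j i) := by
  have h := ((measurableSet_taggedType (P := P) j i).preimage W.measurable_config).inter
    ((measurableSet_markSet (P := P) i j ((P.measurable_configLoss i).const_mul a) U n).preimage
      (W.measurable_config.prodMk W.measurable_marks))
  convert! h using 1

omit [IsProbabilityMeasure μ] in
lemma measurableSet_cover (a : ℝ) (U n : ℕ) (j : LinkType) : MeasurableSet (W.cover a U n j) := by
  rw [W.cover_eq_iUnion]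
  exact MeasurableSet.iUnion fun i => W.measurableSet_coverAt a U n j i

lemma measure_coverAt {a : ℝ} (ha : 0 ≤ a) {U : ℕ} (hU : 1 ≤ U) (n : ℕ) (j : LinkType) (i : ℕ) :
    μ (W.coverAt a U n j i) = ∫⁻ ω, {ω | W.tagged ω = i ∧ W.linkType i ω = j}.indicator
      (fun ω => ENNReal.ofReal (Params.fadingTail (P.η j) (a * W.loss i ω)) *
        (ENNReal.ofReal (P.zeta (P.η j) U) * ENNReal.ofReal (P.kappa n))) ω ∂μ := by
  have hS := ((measurableSet_taggedType (P := P) j i).preimage measurable_fst).inter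
    (measurableSet_markSet (P := P) i j ((P.measurable_configLoss i).const_mul a) U n)
  have h := lintegral_indepFun W.measurable_config W.measurable_marks W.indepFun_config_marks
    (F := fun c z => ((Prod.fst ⁻¹' {c | P.configTagged c = i ∧ P.configType i c = j}) ∩
      {z : Params.Config × ((ℕ → ℕ → ℂ) × (LinkType → ℕ → ℝ) × ℕ) |
        z.2 ∈ markSet P i j (a * P.configLoss i z.1) U n}).indicator 1 (c, z))
    (measurable_one.indicator hS)
  rw [← lintegral_indicator_one (W.measurableSet_coverAt a U n j i)]
  refine Eq.trans (lintegral_congr fun ω => ?_) (h.trans (lintegral_congr fun ω => ?_))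
  · classical
    rw [indicator_apply, indicator_apply]
    refine if_congr ?_ rfl rfl
    simp only [coverAt, mem_ofPred_eq, tagged_eq, linkType_eq, loss_eq, mem_inter_iff, mem_preimage]
  · by_cases hω : P.configTagged (W.config ω) = i ∧ P.configType i (W.config ω) = j
    · have hm : MeasurableSet {ω' | W.marks ω' ∈ markSet P i j (a * W.loss i ω) U n} := by
        have := (measurableSet_markSet (P := P) i j (f := fun _ => a * W.loss i ω)
          measurable_const U n).preimage (W.measurable_config.prodMk W.measurable_marks)
        exact this
      rw [indicator_of_mem (by rw [mem_ofPred_eq, tagged_eq, linkType_eq]; exact hω),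
        ← W.measure_markSet i j (mul_nonneg ha (W.loss_pos i ω).le) hU n,
        ← lintegral_indicator_one hm]
      refine lintegral_congr fun ω' => ?_
      classical
      rw [indicator_apply, indicator_apply]
      refine if_congr ?_ rfl rfl
      simp [hω, loss_eq]
    · rw [indicator_of_notMem (by rw [mem_ofPred_eq, tagged_eq, linkType_eq]; exact hω)]
      simp [indicator, hω]

/-- The pieces by station are summed under the integral. What remains depends only on the serving
type and loss, whose joint law is known. -/
lemma measure_cover {τ : ℝ} (hτ : 0 ≤ τ) {U : ℕ} (hU : 1 ≤ U) (n : ℕ) (j : LinkType) :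
    μ (W.cover (P.η j * τ * U * P.noise / P.G) U n j) =
      ENNReal.ofReal (P.kappa n * P.covTerm j τ U) ∧ 0 ≤ P.covTerm j τ U := by
  have := P.G_pos
  have := P.noise_pos
  have hζ := W.zeta_nonneg j hU
  have hκ := W.kappa_nonneg n
  have ha : 0 ≤ P.η j * τ * U * P.noise / P.G := by positivity
  obtain ⟨hI, hI0⟩ := P.lintegral_fadingTail_mul j hτ U
  set a := P.η j * τ * U * P.noise / P.G
  set C := ENNReal.ofReal (P.zeta (P.η j) U) * ENNReal.ofReal (P.kappa n)
  have hcov : P.covTerm j τ U = P.zeta (P.η j) U * (P.B j * ∑ n ∈ Finset.Icc 1 (P.η j),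
      (-1 : ℝ) ^ (n + 1) * (P.η j).choose n * ∫ l in Ioi (0 : ℝ), P.covIntegrand j τ U n l) := by
    rw [Params.covTerm]; ring
  refine ⟨?_, hcov ▸ mul_nonneg hζ hI0⟩
  have hd : Pairwise (Function.onFun Disjoint (W.coverAt a U n j)) := fun i i' hii => by
    refine Set.disjoint_left.2 fun ω h1 h2 => hii ?_
    exact h1.1.1.symm.trans h2.1.1
  have hF : Measurable fun l => ENNReal.ofReal (Params.fadingTail (P.η j) (a * l)) * C :=
    (((Params.measurable_fadingTail _).comp (measurable_const_mul a)).ennreal_ofReal).mul_const C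
  have hset : ∀ i, MeasurableSet {ω | W.tagged ω = i ∧ W.linkType i ω = j} := fun i => by
    have h := (measurableSet_taggedType (P := P) j i).preimage W.measurable_config
    convert! h using 1
  rw [W.cover_eq_iUnion, measure_iUnion hd fun i => W.measurableSet_coverAt a U n j i]
  simp_rw [W.measure_coverAt ha hU n j]
  have hts := lintegral_tsum (μ := μ) (f := fun i ω =>
    {ω | W.tagged ω = i ∧ W.linkType i ω = j}.indicator
      (fun ω => ENNReal.ofReal (Params.fadingTail (P.η j) (a * W.loss i ω)) * C) ω)
    fun i => ((hF.comp (W.measurable_loss i)).indicator (hset i)).aemeasurable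
  rw [← hts]
  -- Only the index of the serving station contributes.
  have hsum : ∀ ω, ∑' i, {ω | W.tagged ω = i ∧ W.linkType i ω = j}.indicator
      (fun ω => ENNReal.ofReal (Params.fadingTail (P.η j) (a * W.loss i ω)) * C) ω =
      {ω | W.servingType ω = j}.indicator (fun ω =>
        ENNReal.ofReal (Params.fadingTail (P.η j) (a * W.loss (W.tagged ω) ω)) * C) ω := by
    intro ω
    rw [tsum_eq_single (W.tagged ω)]
    · classical
      rw [indicator_apply, indicator_apply]
      exact if_congr (by simp [servingType]) rfl rfl
    · intro i hi
      exact indicator_of_notMem (fun h => hi h.1.symm) _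
  simp_rw [hsum]
  rw [W.lintegral_serving j hF, hcov, mul_left_comm,
    ENNReal.ofReal_mul hζ, ENNReal.ofReal_mul hκ, ← hI, ← mul_assoc]
  simp_rw [mul_right_comm _ C]
  rw [lintegral_mul_const' _ _ (ENNReal.mul_ne_top ENNReal.ofReal_ne_top ENNReal.ofReal_ne_top),
    mul_comm]

omit [IsProbabilityMeasure μ] in
-- With penalty 0 the rate is 0 and cannot exceed a nonnegative τ. With penalty 1 the inequality is
-- solved for the best gain, every factor moved across being positive.
lemma rate_gt_and_load_iff {τ : ℝ} {n : ℕ} (hn : 1 ≤ n) (ω : Ω) (hτ : 0 ≤ τ) :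
    (W.rate ω > τ ∧ W.load ω = n) ↔ ∃ j, ω ∈ W.cover
      (P.η j * P.snrThreshold τ n * (min n P.UM : ℕ) * P.noise / P.G) (min n P.UM) n j := by
  have hG := P.G_pos
  have hno := P.noise_pos
  have hB := P.bandwidth_pos
  have he := P.eff_pos
  have hU : 0 < min n P.UM := lt_min hn P.UM_pos
  have hU' : (0 : ℝ) < (min n P.UM : ℕ) := by exact_mod_cast hU
  have hη : (0 : ℝ) < P.η (W.servingType ω) := by exact_mod_cast P.η_pos _
  have hL := W.loss_pos (W.tagged ω) ω
  have hn' : (0 : ℝ) < n := by exact_mod_cast hn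
  have hbest : 0 ≤ W.bestFading ω := Real.iSup_nonneg fun k => by positivity
  simp only [cover, mem_ofPred_eq, exists_eq_left']
  have key : W.load ω = n → (W.rate ω > τ ↔ P.η (W.servingType ω) * P.snrThreshold τ n *
      (min n P.UM : ℕ) * P.noise / P.G * W.loss (W.tagged ω) ω < W.bestFading ω ∧
      W.zf (W.servingType ω) (min n P.UM) ω = 1) := by
    intro hload
    have hnum : W.numServed ω = min n P.UM := by rw [numServed, hload, min_comm]
    rw [rate, snr, hnum, hload]
    rcases W.zf_range (W.servingType ω) (min n P.UM) ω with h0 | h1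
    · rw [h0]
      simp only [mul_zero, add_zero, Real.logb_one, zero_ne_one, and_false, iff_false, not_lt,
        gt_iff_lt]
      exact hτ
    · simp only [h1, mul_one, and_true]
      set s := P.G / (P.η (W.servingType ω) * (min n P.UM : ℕ) * P.noise) * W.bestFading ω *
        (W.loss (W.tagged ω) ω)⁻¹ with hs
      have hs0 : 0 ≤ s := by positivity
      have h2 : P.eff * (P.bandwidth * (min n P.UM : ℕ) / n) * Real.logb 2 (1 + s) > τ ↔
          τ * n / (P.eff * P.bandwidth * (min n P.UM : ℕ)) < Real.logb 2 (1 + s) := by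
        rw [gt_iff_lt, div_lt_iff₀ (by positivity)]
        rw [show P.eff * (P.bandwidth * (min n P.UM : ℕ) / n) * Real.logb 2 (1 + s) =
          Real.logb 2 (1 + s) * (P.eff * P.bandwidth * (min n P.UM : ℕ)) / n by ring,
          lt_div_iff₀ hn']
      rw [h2, Real.lt_logb_iff_rpow_lt (by norm_num) (by positivity), ← sub_lt_iff_lt_add']
      change P.snrThreshold τ n < s ↔ _
      rw [hs, ← div_eq_mul_inv, lt_div_iff₀ hL]
      rw [show P.G / (P.η (W.servingType ω) * (min n P.UM : ℕ) * P.noise) * W.bestFading ω =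
        W.bestFading ω / (P.η (W.servingType ω) * (min n P.UM : ℕ) * P.noise / P.G) by field_simp,
        lt_div_iff₀ (by positivity)]
      refine iff_of_eq (congrArg (· < _) ?_)
      ring
  constructor
  · rintro ⟨h1, h2⟩
    have := (key h2).1 h1
    exact ⟨this.1, this.2, h2⟩
  · rintro ⟨h1, h2, h3⟩
    exact ⟨(key h3).2 ⟨h1, h2⟩, h3⟩

lemma measure_rate_gt_and_load {τ : ℝ} (hτ : 0 ≤ τ) {n : ℕ} (hn : 1 ≤ n) :
    MeasurableSet {ω | W.rate ω > τ ∧ W.load ω = n} ∧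
    μ.real {ω | W.rate ω > τ ∧ W.load ω = n} =
      P.kappa n * P.S (P.snrThreshold τ n) (min n P.UM) := by
  have hT := P.snrThreshold_nonneg hτ n
  have hU : 1 ≤ min n P.UM := le_min hn P.UM_pos
  have hκ := W.kappa_nonneg n
  set A := fun j => W.cover
      (P.η j * P.snrThreshold τ n * (min n P.UM : ℕ) * P.noise / P.G) (min n P.UM) n j
  have he : {ω | W.rate ω > τ ∧ W.load ω = n} = A .los ∪ A .nlos := by
    ext ω
    rw [mem_ofPred_eq, W.rate_gt_and_load_iff hn ω hτ, mem_union]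
    constructor
    · rintro ⟨j, hj⟩
      cases j
      · exact Or.inl hj
      · exact Or.inr hj
    · rintro (h | h)
      · exact ⟨_, h⟩
      · exact ⟨_, h⟩
  have hm : ∀ j, MeasurableSet (A j) := fun j => W.measurableSet_cover _ _ _ _
  have hd : Disjoint (A .los) (A .nlos) := Set.disjoint_left.2 fun ω h1 h2 => by
    have := h1.1.symm.trans h2.1
    cases this
  obtain ⟨h1, h1'⟩ := W.measure_cover hT hU n .los
  obtain ⟨h2, h2'⟩ := W.measure_cover hT hU n .nlos
  refine ⟨he ▸ (hm _).union (hm _), ?_⟩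
  rw [he, measureReal_def, measure_union hd (hm _)]
  simp only [A]
  rw [h1, h2, ← ENNReal.ofReal_add (mul_nonneg hκ h1') (mul_nonneg hκ h2'),
    ENNReal.toReal_ofReal (add_nonneg (mul_nonneg hκ h1') (mul_nonneg hκ h2')), Params.S]
  ring

/-- κ(0) = 0 makes the load almost surely positive, so the event splits over n ≥ 1 up to a null set.
Convergence is that of a countable sum of probabilities of disjoint events. -/
lemma hasSum_rate {τ : ℝ} (hτ : 0 ≤ τ) :
    HasSum (fun n : ℕ+ => P.kappa n * P.S (P.snrThreshold τ n) (min n P.UM))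
      (μ.real {ω | W.rate ω > τ}) := by
  have h0 : ∀ᵐ ω ∂μ, W.load ω ≠ 0 := by
    have h := W.load_law 0
    rw [Params.kappa, if_pos rfl] at h
    simpa [ae_iff] using (measureReal_eq_zero_iff (μ := μ)).1 h
  have he : ({ω | W.rate ω > τ} : Set Ω) =ᵐ[μ]
      (⋃ n : ℕ+, {ω | W.rate ω > τ ∧ W.load ω = n} : Set Ω) := by
    filter_upwards [h0] with ω hω
    refine propext ⟨fun h => ?_, fun h => ?_⟩
    · exact mem_iUnion.2 ⟨⟨W.load ω, Nat.pos_of_ne_zero hω⟩, h, rfl⟩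
    · obtain ⟨n, hn⟩ := mem_iUnion.1 h
      exact hn.1
  have hd : Pairwise (Function.onFun Disjoint fun n : ℕ+ =>
      {ω | W.rate ω > τ ∧ W.load ω = n}) := fun n m hnm => by
    refine Set.disjoint_left.2 fun ω h1 h2 => hnm ?_
    exact PNat.coe_injective (h1.2.symm.trans h2.2)
  have hu := measure_iUnion (μ := μ) hd fun n => (W.measure_rate_gt_and_load hτ n.2).1
  rw [measureReal_congr he, measureReal_def, hu,
    ENNReal.tsum_toReal_eq fun n => measure_ne_top _ _]
  have hs := ENNReal.hasSum_toReal (hu ▸ measure_ne_top μ _)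
  have hterm : (fun n : ℕ+ => P.kappa n * P.S (P.snrThreshold τ n) (min n P.UM)) =
      fun n : ℕ+ => (μ {ω | W.rate ω > τ ∧ W.load ω = n}).toReal :=
    funext fun n => (W.measure_rate_gt_and_load hτ n.2).2.symm
  rw [hterm]
  exact hs

end Network

end MmWave

theorem theorem2 {Ω : Type*} [MeasurableSpace Ω] (μ : MeasureTheory.Measure Ω)
    [MeasureTheory.IsProbabilityMeasure μ] (P : MmWave.Params) (W : MmWave.Network P μ)
    (τ : ℝ) (hτ : 0 ≤ τ) :
    (∀ (j : MmWave.LinkType) (n : ℕ+), ∀ k ∈ Finset.Icc 1 (P.η j),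
      MeasureTheory.IntegrableOn
        (P.covIntegrand j (P.snrThreshold τ n) (min n P.UM) k) (Set.Ioi 0)) ∧
    HasSum (fun n : ℕ+ => P.kappa n * P.S (P.snrThreshold τ n) (min n P.UM))
      (μ.real {ω | W.rate ω > τ}) :=
  ⟨fun j n k _ => P.integrableOn_covIntegrand j (P.snrThreshold_nonneg hτ n) (min n P.UM) k,
    W.hasSum_rate hτ⟩
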